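/- Let $G$ be a locally compact (Hausdorff) abelian group, written additively, with a fixed Haar measure $ds$. Let $(\Phi,\Psi)$ be a complementary pair of continuous, strictly increasing Young functions $[0,\infty)\to[0,\infty)$; that is, $\Phi$ and $\Psi$ are convex, vanish at $0$, tend to $\infty$ at $\infty$, and $\Psi(y)=\sup\{xy-\Phi(x):x\ge 0\}$ for $y\ge 0$. Let $L^\Phi(G)$ be the Orlicz space of (classes of) measurable $f:G\to\mathbb C$ with $\int_G\Phi(\alpha|f(s)|)\,ds<\infty$ for some $\alpha>0$, with the norm $\|f\|_\Phi=\sup\{\int_G|fv|\,ds:\int_G\Psi(|v|)\,ds\le 1\}$, and let $\mathcal S^\Phi(G)$ be the closure in $L^\Phi(G)$ of the step functions belonging to $L^\Phi(G)$. Let $\omega:G\to(0,\infty)$ be a weight: a measurable, locally integrable function with $\omega(0)=1$, $1/\omega\in L^\infty(G)$ and, for some $C>0$, $\omega(s+t)\le C\,\omega(s)\omega(t)$ for all $s,t\in G$. Put $$L^\Phi_\omega(G)=\{f: f\omega\in L^\Phi(G)\},\qquad \mathcal S^\Phi_\omega(G)=\{f: f\omega\in \mathcal S^\Phi(G)\},\qquad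 \|f\|_{\Phi,\omega}=\|f\omega\|_\Phi .$$ Suppose that $L^\Phi_\omega(G)$ is a Banach algebra under convolution, in the sense of bounded (not necessarily contractive) multiplication: for $f,g\in L^\Phi_\omega(G)$ the integral $(f*g)(x)=\int_G f(s)g(x-s)\,ds$ converges absolutely for almost every $x$, and $(f,g)\mapsto f*g$ is a bounded associative bilinear multiplication on $L^\Phi_\omega(G)$. Suppose further that there is no nonzero continuous group homomorphism $\xi:G\to(\mathbb C,+)$ such that the function $$\tilde\xi(s)=\frac{\xi(s)}{\omega(s)\,\omega(-s)}\qquad(s\in G)$$ belongs to $L^\infty(G)$. Then $A=\mathcal S^\Phi_\omega(G)$ is an algebra under convolution, with bounded multiplication, and it is weakly amenable: every bounded derivation $D:A\to A^*$, i.e. every bounded linear map with $D(ab)=a\cdot D(b)+D(a)\cdot b$, where $(a\cdot\varphi)(c)=\varphi(ca)$ and $(\varphi\cdot a)(c)=\varphi(ac)$, is inner, i.e. there is $\varphi\in A^*$ with $D(a)=a\cdot\varphi-\varphi\cdot a$ for all $a\in A$. -/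

import Mathlib

open MeasureTheory Filter Topology
open scoped NNReal ENNReal Convolution

noncomputable section

namespace WeightedOrlicz

/-! ### Young functions -/

/-- A continuous, strictly increasing Young function `[0, ∞) → [0, ∞)`. A strictly increasing
function cannot take the value `∞`, so the codomain is `ℝ≥0`. -/
structure IsYoungFunction (Φ : ℝ≥0 → ℝ≥0) : Prop where
  convex : ConvexOn ℝ≥0 Set.univ Φ
  map_zero : Φ 0 = 0
  tendsto_atTop : Tendsto Φ atTop atTop
  continuous : Continuous Φ
  strictMono : StrictMono Φ

/-- A complementary pair `(Φ, Ψ)` of continuous, strictly increasing Young functions: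
`Ψ y = sup {x y - Φ x : x ≥ 0}`. -/
structure YoungPair where
  Φ : ℝ≥0 → ℝ≥0
  Ψ : ℝ≥0 → ℝ≥0
  young_left : IsYoungFunction Φ
  young_right : IsYoungFunction Ψ
  isLUB : ∀ y : ℝ≥0, IsLUB (Set.range fun x : ℝ≥0 => (x : ℝ) * y - Φ x) (Ψ y)

theorem YoungPair.young_ineq (Y : YoungPair) (x y : ℝ≥0) : x * y ≤ Y.Φ x + Y.Ψ y := by
  have h := (Y.isLUB y).1 ⟨x, rfl⟩
  have h' : (x : ℝ) * y ≤ Y.Φ x + Y.Ψ y := by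
    simp only at h
    linarith
  exact_mod_cast h'

theorem IsYoungFunction.le_half {Φ : ℝ≥0 → ℝ≥0} (h : IsYoungFunction Φ) (x y : ℝ≥0) :
    Φ (2⁻¹ * x + 2⁻¹ * y) ≤ Φ x + Φ y := by
  have h1 := h.convex.2 (Set.mem_univ x) (Set.mem_univ y) (zero_le (a := (2⁻¹ : ℝ≥0)))
    (zero_le (a := (2⁻¹ : ℝ≥0))) (by rw [← two_mul]; exact mul_inv_cancel₀ two_ne_zero)
  simp only [smul_eq_mul] at h1
  have h2 : (2⁻¹ : ℝ≥0) ≤ 1 := by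
    rw [inv_le_one₀ (by norm_num)]; norm_num
  calc _ ≤ _ := h1
    _ ≤ 1 * Φ x + 1 * Φ y := by gcongr
    _ = _ := by rw [one_mul, one_mul]

/-! ### Orlicz spaces -/

section Orlicz

variable {X : Type*} [MeasurableSpace X]

/-- The modular `∫ Φ(|f|) dμ`. -/
def modular (Φ : ℝ≥0 → ℝ≥0) (μ : Measure X) (f : X → ℂ) : ℝ≥0∞ :=
  ∫⁻ s, (Φ ‖f s‖₊ : ℝ≥0∞) ∂μ

/-- The Orlicz space `L^Φ(μ)`: classes of measurable functions `f` such that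
`∫ Φ(α |f|) dμ < ∞` for some `α > 0`. -/
def orlicz (Y : YoungPair) (μ : Measure X) : Submodule ℂ (X →ₘ[μ] ℂ) where
  carrier := {f | ∃ α : ℝ≥0, 0 < α ∧ modular Y.Φ μ (fun s => (α : ℂ) * f s) < ∞}
  zero_mem' := by
    refine ⟨1, one_pos, ?_⟩
    have : modular Y.Φ μ (fun s => ((1 : ℝ≥0) : ℂ) * (0 : X →ₘ[μ] ℂ) s) = 0 := by
      unfold modular
      rw [lintegral_congr_ae (g := fun _ => 0), lintegral_zero]
      filter_upwards [AEEqFun.coeFn_zero (α := X) (β := ℂ) (μ := μ)] with s hs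
      simp [hs, Y.young_left.map_zero]
    rw [this]
    exact ENNReal.zero_lt_top
  add_mem' := by
    rintro f g ⟨α, hα, hf⟩ ⟨β, hβ, hg⟩
    refine ⟨2⁻¹ * min α β, by positivity, ?_⟩
    refine lt_of_le_of_lt ?_ (ENNReal.add_lt_top.2 ⟨hf, hg⟩)
    have hmeas : AEMeasurable (fun s => (Y.Φ ‖(α : ℂ) * f s‖₊ : ℝ≥0∞)) μ := by
      have h1 : Measurable fun s => (α : ℂ) * f s := f.measurable.const_mul _
      exact (Y.young_left.continuous.measurable.comp h1.nnnorm).coe_nnreal_ennreal.aemeasurable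
    unfold modular
    rw [← lintegral_add_left' hmeas]
    refine lintegral_mono_ae ?_
    filter_upwards [AEEqFun.coeFn_add f g] with s hs
    rw [hs]
    norm_cast
    refine le_trans (Y.young_left.strictMono.monotone ?_) (Y.young_left.le_half _ _)
    simp only [Pi.add_apply, nnnorm_mul]
    have e : ∀ r : ℝ≥0, ‖(r : ℂ)‖₊ = r := fun r => by
      ext; simp
    rw [e, e, e, mul_assoc, ← mul_add]
    gcongr
    calc min α β * ‖f s + g s‖₊ ≤ min α β * (‖f s‖₊ + ‖g s‖₊) := by
          gcongr; exact nnnorm_add_le _ _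
      _ = min α β * ‖f s‖₊ + min α β * ‖g s‖₊ := mul_add _ _ _
      _ ≤ _ := by gcongr <;> simp
  smul_mem' := by
    rintro c f ⟨α, hα, hf⟩
    refine ⟨α / (‖c‖₊ + 1), by positivity, lt_of_le_of_lt ?_ hf⟩
    refine lintegral_mono_ae ?_
    filter_upwards [AEEqFun.coeFn_smul c f] with s hs
    rw [hs]
    norm_cast
    refine Y.young_left.strictMono.monotone ?_
    have e : ∀ r : ℝ≥0, ‖(r : ℂ)‖₊ = r := fun r => by
      ext; simp
    simp only [Pi.smul_apply, smul_eq_mul, nnnorm_mul]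
    rw [e, e, ← mul_assoc]
    gcongr
    rw [div_mul_eq_mul_div, div_le_iff₀ (by positivity)]
    gcongr
    simp

/-- The Orlicz norm `sup {∫ |f v| dμ : ∫ Ψ(|v|) dμ ≤ 1}`, as an extended real number. -/
def orliczENorm (Y : YoungPair) {μ : Measure X} (f : X →ₘ[μ] ℂ) : ℝ≥0∞ :=
  ⨆ (v : X →ₘ[μ] ℂ) (_ : modular Y.Ψ μ v ≤ 1), ∫⁻ s, ‖f s * v s‖ₑ ∂μ

variable {Y : YoungPair} {μ : Measure X}

theorem orliczENorm_lt_top {f : X →ₘ[μ] ℂ} (hf : f ∈ orlicz Y μ) : orliczENorm Y f < ∞ := by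
  obtain ⟨α, hα, hf⟩ := hf
  have hα' : (α : ℝ≥0∞) ≠ 0 := by simpa using hα.ne'
  suffices h : orliczENorm Y f ≤ (modular Y.Φ μ (fun s => (α : ℂ) * f s) + 1) / α from
    lt_of_le_of_lt h (ENNReal.div_lt_top (by simp [hf.ne]) hα')
  refine iSup₂_le fun v hv => ?_
  rw [ENNReal.le_div_iff_mul_le (Or.inl hα') (Or.inl ENNReal.coe_ne_top), mul_comm]
  rw [← lintegral_const_mul' _ _ ENNReal.coe_ne_top]
  have hmeas : Measurable (fun s => (Y.Φ ‖(α : ℂ) * f s‖₊ : ℝ≥0∞)) :=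
    (Y.young_left.continuous.measurable.comp
      (f.measurable.const_mul (α : ℂ)).nnnorm).coe_nnreal_ennreal
  calc ∫⁻ s, (α : ℝ≥0∞) * ‖f s * v s‖ₑ ∂μ
      ≤ ∫⁻ s, ((Y.Φ ‖(α : ℂ) * f s‖₊ : ℝ≥0∞) + (Y.Ψ ‖v s‖₊ : ℝ≥0∞)) ∂μ := by
        refine lintegral_mono fun s => ?_
        have h := Y.young_ineq ‖(α : ℂ) * f s‖₊ ‖v s‖₊
        have e : ‖(α : ℂ)‖₊ = α := by ext; simp
        rw [nnnorm_mul, e] at h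
        simp only [enorm_eq_nnnorm, nnnorm_mul, e]
        rw [mul_assoc] at h
        exact_mod_cast h
    _ = modular Y.Φ μ (fun s => (α : ℂ) * f s) + modular Y.Ψ μ v := lintegral_add_left hmeas _
    _ ≤ _ := by gcongr

theorem orliczENorm_zero : orliczENorm Y (0 : X →ₘ[μ] ℂ) = 0 := by
  refine le_antisymm (iSup₂_le fun v _ => ?_) zero_le
  rw [lintegral_congr_ae (g := fun _ => 0), lintegral_zero]
  filter_upwards [AEEqFun.coeFn_zero (α := X) (β := ℂ) (μ := μ)] with s hs
  simp [hs]

theorem orliczENorm_add_le (f g : X →ₘ[μ] ℂ) :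
    orliczENorm Y (f + g) ≤ orliczENorm Y f + orliczENorm Y g := by
  refine iSup₂_le fun v hv => ?_
  calc ∫⁻ s, ‖(f + g : X →ₘ[μ] ℂ) s * v s‖ₑ ∂μ
      ≤ ∫⁻ s, (‖f s * v s‖ₑ + ‖g s * v s‖ₑ) ∂μ := by
        refine lintegral_mono_ae ?_
        filter_upwards [AEEqFun.coeFn_add f g] with s hs
        rw [hs, Pi.add_apply, add_mul]
        exact enorm_add_le _ _
    _ = ∫⁻ s, ‖f s * v s‖ₑ ∂μ + ∫⁻ s, ‖g s * v s‖ₑ ∂μ :=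
        lintegral_add_left (f.measurable.mul v.measurable).enorm _
    _ ≤ _ := add_le_add
        (le_iSup₂ (f := fun (v : X →ₘ[μ] ℂ) (_ : modular Y.Ψ μ v ≤ 1) =>
          ∫⁻ s, ‖f s * v s‖ₑ ∂μ) v hv)
        (le_iSup₂ (f := fun (v : X →ₘ[μ] ℂ) (_ : modular Y.Ψ μ v ≤ 1) =>
          ∫⁻ s, ‖g s * v s‖ₑ ∂μ) v hv)

theorem orliczENorm_smul (c : ℂ) (f : X →ₘ[μ] ℂ) :
    orliczENorm Y (c • f) = ‖c‖ₑ * orliczENorm Y f := by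
  unfold orliczENorm
  simp only [ENNReal.mul_iSup]
  refine iSup_congr fun v => iSup_congr fun _ => ?_
  rw [← lintegral_const_mul' _ _ enorm_ne_top]
  refine lintegral_congr_ae ?_
  filter_upwards [AEEqFun.coeFn_smul c f] with s hs
  rw [hs, Pi.smul_apply, smul_eq_mul, mul_assoc, enorm_mul]

theorem eq_zero_of_orliczENorm_eq_zero {f : X →ₘ[μ] ℂ} (hf : f ∈ orlicz Y μ)
    (h : orliczENorm Y f = 0) : f = 0 := by
  obtain ⟨α, hα, hf⟩ := hf
  have hsmall : ∀ n : ℕ, μ {s | 1 / ((n : ℝ≥0) + 1) ≤ ‖f s‖₊} = 0 := by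
    intro n
    set ε : ℝ≥0 := 1 / ((n : ℝ≥0) + 1) with hε
    have hεpos : 0 < ε := by positivity
    set A : Set X := {s | ε ≤ ‖f s‖₊} with hA
    have hAm : MeasurableSet A := measurableSet_le measurable_const f.measurable.nnnorm
    have hΦpos : 0 < Y.Φ (α * ε) := by
      rw [← Y.young_left.map_zero]
      exact Y.young_left.strictMono (by positivity)
    have hAfin : μ A ≠ ∞ := by
      intro htop
      have h1 : (Y.Φ (α * ε) : ℝ≥0∞) * μ A ≤ modular Y.Φ μ (fun s => (α : ℂ) * f s) := by
        rw [← setLIntegral_const]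
        refine le_trans (setLIntegral_mono' hAm fun s hs => ?_) (setLIntegral_le_lintegral A _)
        norm_cast
        refine Y.young_left.strictMono.monotone ?_
        have e : ‖(α : ℂ)‖₊ = α := by ext; simp
        rw [nnnorm_mul, e]
        gcongr
        exact hs
      rw [htop, ENNReal.mul_top (by exact_mod_cast hΦpos.ne')] at h1
      exact absurd hf (not_lt.2 h1)
    obtain ⟨c, hc, hcA⟩ : ∃ c : ℝ≥0, 0 < c ∧ (Y.Ψ c : ℝ≥0∞) * μ A ≤ 1 := by
      have hpos : 0 < ((μ A).toNNReal + 1)⁻¹ := by positivity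
      have hcont : ∀ᶠ c in 𝓝 (0 : ℝ≥0), Y.Ψ c < ((μ A).toNNReal + 1)⁻¹ := by
        have := Y.young_right.continuous.tendsto 0
        rw [Y.young_right.map_zero] at this
        exact this.eventually (gt_mem_nhds hpos)
      obtain ⟨c, hc, hlt⟩ := ((hcont.filter_mono nhdsWithin_le_nhds).and
        (self_mem_nhdsWithin (s := Set.Ioi (0 : ℝ≥0)))).exists
      refine ⟨c, hlt, ?_⟩
      rw [← ENNReal.coe_toNNReal hAfin]
      norm_cast
      calc Y.Ψ c * (μ A).toNNReal ≤ ((μ A).toNNReal + 1)⁻¹ * ((μ A).toNNReal + 1) := by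
            gcongr
            simp
        _ = 1 := inv_mul_cancel₀ (by positivity)
    have hec : ‖(c : ℂ)‖₊ = c := by ext; simp
    set v : X →ₘ[μ] ℂ := AEEqFun.mk (A.indicator fun _ => (c : ℂ))
      (stronglyMeasurable_const.indicator hAm).aestronglyMeasurable with hv
    have hvae : v =ᵐ[μ] A.indicator fun _ => (c : ℂ) := AEEqFun.coeFn_mk _ _
    have hvmod : modular Y.Ψ μ v ≤ 1 := by
      refine le_trans (le_of_eq ?_) hcA
      unfold modular
      rw [← setLIntegral_const, ← lintegral_indicator hAm]
      refine lintegral_congr_ae ?_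
      filter_upwards [hvae] with s hs
      rw [hs]
      by_cases hsA : s ∈ A
      · simp [hsA, hec]
      · simp [hsA, Y.young_right.map_zero]
    have hint : ∫⁻ s, ‖f s * v s‖ₑ ∂μ = 0 := by
      refine le_antisymm ?_ zero_le
      rw [← h]
      exact le_iSup₂ (f := fun (v : X →ₘ[μ] ℂ) (_ : modular Y.Ψ μ v ≤ 1) =>
        ∫⁻ s, ‖f s * v s‖ₑ ∂μ) v hvmod
    have hlow : ((ε * c : ℝ≥0) : ℝ≥0∞) * μ A ≤ 0 := by
      rw [← hint, ← setLIntegral_const, ← lintegral_indicator hAm]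
      refine lintegral_mono_ae ?_
      filter_upwards [hvae] with s hs
      rw [hs]
      by_cases hsA : s ∈ A
      · simp only [Set.indicator_of_mem hsA, enorm_eq_nnnorm, nnnorm_mul, hec]
        have : ε ≤ ‖f s‖₊ := hsA
        norm_cast
        gcongr
      · simp [hsA]
    have h0 := le_antisymm hlow zero_le
    rcases mul_eq_zero.1 h0 with h1 | h1
    · exact absurd (by exact_mod_cast h1) (mul_pos hεpos hc).ne'
    · exact h1
  refine AEEqFun.ext ?_
  have hall : ∀ᵐ s ∂μ, ∀ n : ℕ, ¬ (1 / ((n : ℝ≥0) + 1) ≤ ‖f s‖₊) :=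
    ae_all_iff.2 fun n => by
      rw [ae_iff]
      simpa using hsmall n
  filter_upwards [hall, AEEqFun.coeFn_zero (α := X) (β := ℂ) (μ := μ)] with s hs hz
  rw [hz]
  by_contra hne
  have hpos : 0 < ‖f s‖₊ := nnnorm_pos.2 (by simpa using hne)
  obtain ⟨n, hn⟩ := exists_nat_one_div_lt (K := ℝ) (ε := ‖f s‖) (by exact_mod_cast hpos)
  exact hs n (by
    rw [← NNReal.coe_le_coe]
    push_cast
    exact hn.le)

/-- `L^Φ(μ)` with the Orlicz norm. -/
instance instNormedAddCommGroupOrlicz : NormedAddCommGroup (orlicz Y μ) :=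
  AddGroupNorm.toNormedAddCommGroup
    { toFun := fun f => (orliczENorm Y (f : X →ₘ[μ] ℂ)).toReal
      map_zero' := by simp [orliczENorm_zero]
      add_le' := fun f g => by
        rw [← ENNReal.toReal_add (orliczENorm_lt_top f.2).ne (orliczENorm_lt_top g.2).ne]
        refine ENNReal.toReal_mono ?_ (orliczENorm_add_le _ _)
        exact ENNReal.add_ne_top.2 ⟨(orliczENorm_lt_top f.2).ne, (orliczENorm_lt_top g.2).ne⟩
      neg' := fun f => by
        have h := orliczENorm_smul (Y := Y) (-1) (f : X →ₘ[μ] ℂ)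
        have h' : (-1 : ℂ) • (f : X →ₘ[μ] ℂ) = -f := neg_one_smul ℂ (f : X →ₘ[μ] ℂ)
        rw [h'] at h
        rw [Submodule.coe_neg, h]
        simp
      eq_zero_of_map_eq_zero' := fun f hf => by
        refine Subtype.ext (eq_zero_of_orliczENorm_eq_zero f.2 ?_)
        rcases (ENNReal.toReal_eq_zero_iff _).1 hf with h | h
        · exact h
        · exact absurd h (orliczENorm_lt_top f.2).ne }

theorem norm_orlicz_def (f : orlicz Y μ) :
    ‖f‖ = (orliczENorm Y (f : X →ₘ[μ] ℂ)).toReal := rfl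

instance instNormedSpaceOrlicz : NormedSpace ℂ (orlicz Y μ) where
  norm_smul_le c f := by
    rw [norm_orlicz_def, norm_orlicz_def, Submodule.coe_smul, orliczENorm_smul,
      ENNReal.toReal_mul, toReal_enorm]

variable (Y μ)

/-- The step functions (measurable functions with finitely many values) in `L^Φ(μ)`. -/
def stepFunctions : Submodule ℂ (orlicz Y μ) where
  carrier := {f | ∃ g : SimpleFunc X ℂ, (f : X →ₘ[μ] ℂ) =ᵐ[μ] g}
  zero_mem' := ⟨0, by
    filter_upwards [AEEqFun.coeFn_zero (α := X) (β := ℂ) (μ := μ)] with s hs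
    simpa using hs⟩
  add_mem' := by
    rintro f f' ⟨g, hg⟩ ⟨g', hg'⟩
    refine ⟨g + g', ?_⟩
    filter_upwards [AEEqFun.coeFn_add (f : X →ₘ[μ] ℂ) f', hg, hg'] with s h1 h2 h3
    simp [h1, h2, h3]
  smul_mem' := by
    rintro c f ⟨g, hg⟩
    refine ⟨c • g, ?_⟩
    filter_upwards [AEEqFun.coeFn_smul c (f : X →ₘ[μ] ℂ), hg] with s h1 h2
    simp [h1, h2]

/-- `S^Φ(μ)`: the closure of the step functions in `L^Φ(μ)`. -/
def orliczS : Submodule ℂ (orlicz Y μ) := (stepFunctions Y μ).topologicalClosure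

end Orlicz

/-! ### Weights and weighted Orlicz spaces -/

section Weighted

variable {G : Type*} [AddCommGroup G] [TopologicalSpace G] [MeasurableSpace G]

/-- A weight on the (additively written) group `G` with Haar measure `μ`. -/
structure Weight (μ : Measure G) where
  toFun : G → ℝ
  pos : ∀ s, 0 < toFun s
  map_zero : toFun 0 = 1
  aemeasurable : AEMeasurable toFun μ
  locallyIntegrable : LocallyIntegrable toFun μ
  inv_memLp_top : MemLp (fun s => (toFun s)⁻¹) ∞ μ
  weakly_submultiplicative :
    ∃ C : ℝ, 0 < C ∧ ∀ s t, toFun (s + t) ≤ C * (toFun s * toFun t)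

instance {μ : Measure G} : CoeFun (Weight μ) fun _ => G → ℝ := ⟨Weight.toFun⟩

variable {μ : Measure G}

theorem Weight.aestronglyMeasurable (ω : Weight μ) :
    AEStronglyMeasurable (fun s => (ω s : ℂ)) μ :=
  (Complex.measurable_ofReal.comp_aemeasurable ω.aemeasurable).aestronglyMeasurable

/-- The linear map `f ↦ f ω` on classes of measurable functions. -/
def mulWeight (ω : Weight μ) : (G →ₘ[μ] ℂ) →ₗ[ℂ] (G →ₘ[μ] ℂ) where
  toFun f := f * AEEqFun.mk (fun s => (ω s : ℂ)) ω.aestronglyMeasurable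
  map_add' f g := by
    refine AEEqFun.ext ?_
    set w : G →ₘ[μ] ℂ := AEEqFun.mk (fun s => (ω s : ℂ)) ω.aestronglyMeasurable
    filter_upwards [AEEqFun.coeFn_mul (f + g) w, AEEqFun.coeFn_add f g,
      AEEqFun.coeFn_add (f * w) (g * w), AEEqFun.coeFn_mul f w, AEEqFun.coeFn_mul g w]
      with s h1 h2 h3 h4 h5
    simp [h1, h2, h3, h4, h5, add_mul]
  map_smul' c f := by
    refine AEEqFun.ext ?_
    set w : G →ₘ[μ] ℂ := AEEqFun.mk (fun s => (ω s : ℂ)) ω.aestronglyMeasurable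
    filter_upwards [AEEqFun.coeFn_mul (c • f) w, AEEqFun.coeFn_smul c f,
      AEEqFun.coeFn_smul c (f * w), AEEqFun.coeFn_mul f w] with s h1 h2 h3 h4
    simp [h1, h2, h3, h4, mul_assoc]

theorem coeFn_mulWeight (ω : Weight μ) (f : G →ₘ[μ] ℂ) :
    mulWeight ω f =ᵐ[μ] fun s => f s * (ω s : ℂ) := by
  filter_upwards [AEEqFun.coeFn_mul f (AEEqFun.mk (fun s => (ω s : ℂ)) ω.aestronglyMeasurable),
    AEEqFun.coeFn_mk (fun s => (ω s : ℂ)) ω.aestronglyMeasurable] with s h1 h2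
  change (f * AEEqFun.mk (fun s => (ω s : ℂ)) ω.aestronglyMeasurable : G →ₘ[μ] ℂ) s = _
  rw [h1, Pi.mul_apply, h2]

theorem mulWeight_injective (ω : Weight μ) : Function.Injective (mulWeight ω) := by
  intro f g h
  refine AEEqFun.ext ?_
  have h' : mulWeight ω f =ᵐ[μ] mulWeight ω g := by rw [h]
  filter_upwards [h', coeFn_mulWeight ω f, coeFn_mulWeight ω g] with s h1 h2 h3
  rw [h2, h3] at h1
  exact mul_right_cancel₀ (by exact_mod_cast (ω.pos s).ne') h1

/-- The weighted Orlicz space `L^Φ_ω(G) = {f : f ω ∈ L^Φ(G)}`. -/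
def weightedOrlicz (Y : YoungPair) (ω : Weight μ) : Submodule ℂ (G →ₘ[μ] ℂ) :=
  (orlicz Y μ).comap (mulWeight ω)

/-- The map `f ↦ f ω` from `L^Φ_ω(G)` to `L^Φ(G)`. -/
def toOrlicz (Y : YoungPair) (ω : Weight μ) : weightedOrlicz Y ω →ₗ[ℂ] orlicz Y μ :=
  (mulWeight ω).restrict fun _ hf => hf

theorem toOrlicz_injective (Y : YoungPair) (ω : Weight μ) :
    Function.Injective (toOrlicz Y ω) := fun _ _ h =>
  Subtype.ext (mulWeight_injective ω (congrArg Subtype.val h))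

/-- `L^Φ_ω(G)` carries the norm `‖f‖_{Φ,ω} = ‖f ω‖_Φ`. -/
instance instNormedAddCommGroupWeighted (Y : YoungPair) (ω : Weight μ) :
    NormedAddCommGroup (weightedOrlicz Y ω) :=
  NormedAddCommGroup.induced (weightedOrlicz Y ω) (orlicz Y μ) (toOrlicz Y ω)
    (toOrlicz_injective Y ω)

instance instNormedSpaceWeighted (Y : YoungPair) (ω : Weight μ) :
    NormedSpace ℂ (weightedOrlicz Y ω) :=
  NormedSpace.induced ℂ (weightedOrlicz Y ω) (orlicz Y μ) (toOrlicz Y ω)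

/-- `S^Φ_ω(G) = {f : f ω ∈ S^Φ(G)}`, a subspace of `L^Φ_ω(G)` (with the norm of `L^Φ_ω(G)`). -/
def weightedOrliczS (Y : YoungPair) (ω : Weight μ) : Submodule ℂ (weightedOrlicz Y ω) :=
  (orliczS Y μ).comap (toOrlicz Y ω)

end Weighted

/-! ### Algebras with bounded multiplication and weak amenability -/

/-- A bounded (not necessarily contractive) associative bilinear multiplication on a complex
normed space. -/
structure BoundedMul (A : Type*) [NormedAddCommGroup A] [NormedSpace ℂ A] where
  mul : A →L[ℂ] A →L[ℂ] A
  assoc : ∀ a b c, mul (mul a b) c = mul a (mul b c)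

namespace BoundedMul

variable {A : Type*} [NormedAddCommGroup A] [NormedSpace ℂ A] (m : BoundedMul A)

/-- The left module action `(a · φ)(c) = φ(c a)` of `A` on `A*`. -/
def dualLeft (a : A) (φ : A →L[ℂ] ℂ) : A →L[ℂ] ℂ := φ.comp (m.mul.flip a)

/-- The right module action `(φ · a)(c) = φ(a c)` of `A` on `A*`. -/
def dualRight (φ : A →L[ℂ] ℂ) (a : A) : A →L[ℂ] ℂ := φ.comp (m.mul a)

/-- `D : A → A*` is a derivation: `D(ab) = a · D(b) + D(a) · b`. -/
def IsDerivation (D : A →L[ℂ] (A →L[ℂ] ℂ)) : Prop :=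
  ∀ a b, D (m.mul a b) = m.dualLeft a (D b) + m.dualRight (D a) b

/-- `D : A → A*` is inner: `D(a) = a · φ - φ · a` for some `φ ∈ A*`. -/
def IsInner (D : A →L[ℂ] (A →L[ℂ] ℂ)) : Prop :=
  ∃ φ : A →L[ℂ] ℂ, ∀ a, D a = m.dualLeft a φ - m.dualRight φ a

/-- Every bounded derivation `A → A*` is inner. -/
def IsWeaklyAmenable : Prop :=
  ∀ D : A →L[ℂ] (A →L[ℂ] ℂ), m.IsDerivation D → m.IsInner D

/-- The multiplication `m` on the space `A` of (classes of) functions on `G` is convolution: for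
all `f, g ∈ A` the integral `(f * g)(x) = ∫ f(t) g(x - t) dt` converges absolutely for almost every
`x`, and `m` sends `(f, g)` to the class of `f * g`. The map `ι` is the inclusion of `A` into the
space of all classes of measurable functions. -/
def IsConvolution {G : Type*} [AddCommGroup G] [MeasurableSpace G] {μ : Measure G}
    (ι : A → (G →ₘ[μ] ℂ)) : Prop :=
  ∀ f g : A,
    (∀ᵐ x ∂μ, ConvolutionExistsAt (ι f) (ι g) x (ContinuousLinearMap.mul ℂ ℂ) μ) ∧
      ι (m.mul f g) =ᵐ[μ] (ι f) ⋆[ContinuousLinearMap.mul ℂ ℂ, μ] (ι g)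

end BoundedMul

section Algebra

variable {G : Type*} [AddCommGroup G] [TopologicalSpace G] [MeasurableSpace G] {μ : Measure G}

/-- `L^Φ_ω(G)` is a Banach algebra under convolution. -/
def IsWeightedOrliczAlgebra (Y : YoungPair) (ω : Weight μ) : Prop :=
  ∃ m : BoundedMul (weightedOrlicz Y ω),
    m.IsConvolution (fun f => (f : G →ₘ[μ] ℂ))

/-- `S^Φ_ω(G)` is an algebra under convolution (with bounded multiplication), and this algebra is
weakly amenable. The multiplication is unique, being given by convolution. -/
def IsWeaklyAmenableS (Y : YoungPair) (ω : Weight μ) : Prop :=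
  ∃ m : BoundedMul (weightedOrliczS Y ω),
    m.IsConvolution (fun f => ((f : weightedOrlicz Y ω) : G →ₘ[μ] ℂ)) ∧ m.IsWeaklyAmenable

end Algebra

end WeightedOrlicz

end

/-! The algebra is commutative, so inner derivations vanish and the claim is that every bounded
derivation `D` is zero. Since `C_c(G)` is dense in `S^Φ_ω(G)` (`denseRange_ccEmbed`), it suffices to
study `D(f)(k)` for `f, k` in `C_c(G)`; density also shows that convolution preserves `S^Φ_ω(G)`.

Write `τ_t` for translation and consider the defect `Δ_t(f, k) = D(τ_t f)(τ_{-t} k) - D(f)(k)`. A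
translation can be moved between the factors of a convolution, so the derivation identity makes
`Δ_t(f, g * c)` invariant under cyclic permutation of `f, g, c` (`translationDefect_rotate`). This
turns the obvious cocycle identity into additivity in `t` (`translationDefect_add`). The defect is
continuous in `t` and, as translation by `t` costs a factor `C ω(t)` in norm, it is at most a
multiple of `ω(t) ω(-t)`. It is therefore one of the excluded homomorphisms unless it vanishes.

Once the defect is zero, `D(τ_t f)(k) = D(f)(τ_t k)` for `k = g * c`. Integrating against `h(t)`,
which is legitimate by `apply_ccEmbed_ccConv`, gives `D(h * f)(k) = D(f)(h * k)`. The derivation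
identity reads `D(h * f)(k) = D(f)(k * h) + D(h)(f * k)`, so `D(h)(f * g * c) = 0`. Approximate
identities remove `f` and `g`, and density gives `D = 0`. -/

namespace WeightedOrlicz

/-! ### Estimates in Orlicz spaces -/

section Orlicz

variable {X : Type*} [MeasurableSpace X] {Y : YoungPair} {μ : Measure X}

theorem nnnorm_coe_nnreal (r : ℝ≥0) : ‖(r : ℂ)‖₊ = r := by
  ext; simp

/-- A Young function lies below its chords through the origin. -/
theorem IsYoungFunction.mul_le {Φ : ℝ≥0 → ℝ≥0} (h : IsYoungFunction Φ) {x M : ℝ≥0}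
    (hx : x ≤ M) : M * Φ x ≤ x * Φ M := by
  rcases eq_or_ne M 0 with rfl | hM
  · simp
  have hle : x / M ≤ 1 := div_le_one_of_le₀ hx zero_le
  have h1 := h.convex.2 (Set.mem_univ M) (Set.mem_univ 0) (zero_le (a := x / M))
    (zero_le (a := 1 - x / M)) (add_tsub_cancel_of_le hle)
  simp only [smul_eq_mul, mul_zero, add_zero, h.map_zero] at h1
  rw [div_mul_cancel₀ _ hM] at h1
  calc M * Φ x ≤ M * (x / M * Φ M) := by gcongr
    _ = x * Φ M := by field_simp

theorem orliczENorm_mono {f g : X →ₘ[μ] ℂ} (h : ∀ᵐ s ∂μ, ‖f s‖ₑ ≤ ‖g s‖ₑ) :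
    orliczENorm Y f ≤ orliczENorm Y g := by
  refine iSup₂_mono fun v _ => lintegral_mono_ae ?_
  filter_upwards [h] with s hs
  rw [enorm_mul, enorm_mul]
  gcongr

theorem orliczENorm_le_mul {f g : X →ₘ[μ] ℂ} (c : ℝ≥0)
    (h : ∀ᵐ s ∂μ, ‖f s‖ ≤ c * ‖g s‖) : orliczENorm Y f ≤ c * orliczENorm Y g := by
  have hc : ‖(c : ℂ)‖ₑ = c := by rw [enorm_eq_nnnorm, nnnorm_coe_nnreal]
  rw [← hc, ← orliczENorm_smul]
  refine orliczENorm_mono ?_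
  filter_upwards [h, AEEqFun.coeFn_smul (c : ℂ) g] with s h1 h2
  rw [h2, Pi.smul_apply, smul_eq_mul, enorm_mul, hc, enorm_eq_nnnorm, enorm_eq_nnnorm]
  exact_mod_cast h1

theorem mem_orlicz_of_norm_le_mul {f g : X →ₘ[μ] ℂ} (hg : g ∈ orlicz Y μ) (c : ℝ≥0)
    (h : ∀ᵐ s ∂μ, ‖f s‖ ≤ c * ‖g s‖) : f ∈ orlicz Y μ := by
  obtain ⟨α, hα, hm⟩ := (orlicz Y μ).smul_mem (c : ℂ) hg
  refine ⟨α, hα, lt_of_le_of_lt (lintegral_mono_ae ?_) hm⟩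
  filter_upwards [h, AEEqFun.coeFn_smul (c : ℂ) g] with s h1 h2
  refine ENNReal.coe_le_coe.2 (Y.young_left.strictMono.monotone ?_)
  rw [h2, Pi.smul_apply, smul_eq_mul, nnnorm_mul, nnnorm_mul, nnnorm_mul, nnnorm_coe_nnreal c]
  gcongr
  exact_mod_cast h1

/-- Young's inequality applied to `α|f|` and an admissible `|v|`; the modular of `v` contributes at
most `1`. -/
theorem mul_orliczENorm_le (f : X →ₘ[μ] ℂ) (α : ℝ≥0) :
    α * orliczENorm Y f ≤ modular Y.Φ μ (fun s => (α : ℂ) * f s) + 1 := by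
  unfold orliczENorm
  simp only [ENNReal.mul_iSup]
  refine iSup₂_le fun v hv => ?_
  rw [← lintegral_const_mul' _ _ ENNReal.coe_ne_top]
  have hmeas : Measurable (fun s => (Y.Φ ‖(α : ℂ) * f s‖₊ : ℝ≥0∞)) :=
    (Y.young_left.continuous.measurable.comp
      (f.measurable.const_mul (α : ℂ)).nnnorm).coe_nnreal_ennreal
  calc ∫⁻ s, (α : ℝ≥0∞) * ‖f s * v s‖ₑ ∂μ
      ≤ ∫⁻ s, ((Y.Φ ‖(α : ℂ) * f s‖₊ : ℝ≥0∞) + (Y.Ψ ‖v s‖₊ : ℝ≥0∞)) ∂μ := by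
        refine lintegral_mono fun s => ?_
        have h := Y.young_ineq ‖(α : ℂ) * f s‖₊ ‖v s‖₊
        rw [nnnorm_mul, nnnorm_coe_nnreal] at h
        simp only [enorm_eq_nnnorm, nnnorm_mul, nnnorm_coe_nnreal]
        rw [mul_assoc] at h
        exact_mod_cast h
    _ = modular Y.Φ μ (fun s => (α : ℂ) * f s) + modular Y.Ψ μ v := lintegral_add_left hmeas _
    _ ≤ _ := by gcongr

/-- On `[0, αM]` the function `Φ` lies below its chord, so for bounded `f` the modular is controlled
by the `L¹` norm. -/
theorem mul_modular_le {f : X →ₘ[μ] ℂ} {M : ℝ≥0} (α : ℝ≥0) (hα : 0 < α)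
    (hM : ∀ᵐ s ∂μ, ‖f s‖₊ ≤ M) :
    M * modular Y.Φ μ (fun s => (α : ℂ) * f s) ≤ Y.Φ (α * M) * ∫⁻ s, ‖f s‖ₑ ∂μ := by
  unfold modular
  rw [← lintegral_const_mul' _ _ ENNReal.coe_ne_top, ← lintegral_const_mul' _ _ ENNReal.coe_ne_top]
  refine lintegral_mono_ae ?_
  filter_upwards [hM] with s hs
  have h := Y.young_left.mul_le (mul_le_mul_right hs α)
  rw [nnnorm_mul, nnnorm_coe_nnreal, enorm_eq_nnnorm]
  norm_cast
  rw [mul_assoc, mul_assoc] at h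
  have := le_of_mul_le_mul_left h hα
  rwa [mul_comm (Y.Φ _)]

/-- On bounded functions, smallness in `L¹` implies smallness in the Orlicz norm. -/
theorem exists_orliczENorm_le (Y : YoungPair) (M : ℝ≥0) {ε : ℝ≥0} (hε : 0 < ε) :
    ∃ δ : ℝ≥0, 0 < δ ∧ ∀ f : X →ₘ[μ] ℂ, (∀ᵐ s ∂μ, ‖f s‖₊ ≤ M) →
      ∫⁻ s, ‖f s‖ₑ ∂μ ≤ δ → orliczENorm Y f ≤ ε := by
  -- Here `N` replaces `M` to be positive. The choice of `δ` below makes the modular of `αf` at most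
  -- `1`, whence `α‖f‖ ≤ 2 = αε`.
  set N : ℝ≥0 := M + 1
  set α : ℝ≥0 := 2 / ε
  have hα : 0 < α := by positivity
  refine ⟨N / (Y.Φ (α * N) + 1), by positivity, fun f hM hδ => ?_⟩
  have h1 := mul_modular_le (Y := Y) (μ := μ) (f := f) (M := N) α hα
    (hM.mono fun s hs => hs.trans (le_add_of_nonneg_right zero_le))
  have h2 : (N : ℝ≥0∞) * modular Y.Φ μ (fun s => (α : ℂ) * f s) ≤ N * 1 := by
    refine h1.trans ?_
    calc (Y.Φ (α * N) : ℝ≥0∞) * ∫⁻ s, ‖f s‖ₑ ∂μ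
        ≤ Y.Φ (α * N) * ((N / (Y.Φ (α * N) + 1) : ℝ≥0) : ℝ≥0∞) := by gcongr
      _ ≤ N * 1 := by
        norm_cast
        rw [mul_one, mul_div_assoc', div_le_iff₀ (by positivity), mul_comm]
        gcongr
        simp
  have hN0 : (N : ℝ≥0∞) ≠ 0 := by simp [N]
  have h3 : modular Y.Φ μ (fun s => (α : ℂ) * f s) ≤ 1 :=
    (ENNReal.mul_le_mul_iff_right hN0 ENNReal.coe_ne_top).1 h2
  have h4 : (α : ℝ≥0∞) * orliczENorm Y f ≤ α * ε := by
    refine (mul_orliczENorm_le f α).trans ((add_le_add_left h3 1).trans (le_of_eq ?_))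
    norm_cast
    rw [div_mul_cancel₀ _ hε.ne']
    norm_num
  exact (ENNReal.mul_le_mul_iff_right (by simpa using hα.ne') ENNReal.coe_ne_top).1 h4

theorem mem_orlicz_of_bounded {f : X →ₘ[μ] ℂ} {M : ℝ≥0} (hM : ∀ᵐ s ∂μ, ‖f s‖₊ ≤ M)
    (hf : ∫⁻ s, ‖f s‖ₑ ∂μ < ∞) : f ∈ orlicz Y μ := by
  refine ⟨1, one_pos, ?_⟩
  have h1 := mul_modular_le (Y := Y) (μ := μ) (f := f) (M := M + 1) 1 one_pos
    (hM.mono fun s hs => hs.trans (le_add_of_nonneg_right zero_le))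
  have h2 := lt_of_le_of_lt h1 (ENNReal.mul_lt_top ENNReal.coe_lt_top hf)
  by_contra h
  rw [not_lt, top_le_iff] at h
  rw [h, ENNReal.mul_top (by simp)] at h2
  exact absurd h2 (lt_irrefl _)

theorem norm_orlicz_le {f : orlicz Y μ} {ε : ℝ≥0} (h : orliczENorm Y (f : X →ₘ[μ] ℂ) ≤ ε) :
    ‖f‖ ≤ ε := by
  rw [norm_orlicz_def]
  exact ENNReal.toReal_le_coe_of_le_coe h

/-- Bounded integrable functions are limits of step functions. -/
theorem mem_orliczS_of_bounded {f : orlicz Y μ} {M : ℝ≥0}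
    (hM : ∀ᵐ s ∂μ, ‖(f : X →ₘ[μ] ℂ) s‖₊ ≤ M)
    (hf : ∫⁻ s, ‖(f : X →ₘ[μ] ℂ) s‖ₑ ∂μ < ∞) : f ∈ orliczS Y μ := by
  set F : X → ℂ := ((f : X →ₘ[μ] ℂ) : X → ℂ) with hF
  have hFm : Measurable F := (f : X →ₘ[μ] ℂ).measurable
  have hFi : Integrable F μ := ⟨hFm.aestronglyMeasurable, hf⟩
  rw [orliczS, ← SetLike.mem_coe, Submodule.topologicalClosure_coe, Metric.mem_closure_iff]
  intro ε hε
  lift ε to ℝ≥0 using hε.le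
  -- The simple approximants satisfy `|g| ≤ 2|f|`, so `|g - f| ≤ 3M`; on such functions `L¹`
  -- convergence gives Orlicz convergence.
  obtain ⟨δ, hδ, hδ'⟩ := exists_orliczENorm_le (μ := μ) Y (3 * M) (ε := ε / 2)
    (by have : 0 < ε := by exact_mod_cast hε
        positivity)
  have hlim := SimpleFunc.tendsto_approxOn_range_L1_enorm (μ := μ) hFm hFi
  obtain ⟨n, hn⟩ := (hlim.eventually (ge_mem_nhds
    (show (0 : ℝ≥0∞) < δ by exact_mod_cast hδ))).exists
  set g : SimpleFunc X ℂ := SimpleFunc.approxOn F hFm (Set.range F ∪ {0}) 0 (by simp) n with hg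
  have hgb : ∀ s, ‖g s‖ ≤ ‖F s‖ + ‖F s‖ := fun s =>
    SimpleFunc.norm_approxOn_zero_le hFm (by simp) s n
  set gc : X →ₘ[μ] ℂ := AEEqFun.mk g g.aestronglyMeasurable with hgc
  have hgae : gc =ᵐ[μ] g := AEEqFun.coeFn_mk _ _
  have hgmem : gc ∈ orlicz Y μ := by
    refine mem_orlicz_of_norm_le_mul f.2 2 ?_
    filter_upwards [hgae] with s hs
    rw [hs]
    refine (hgb s).trans (le_of_eq ?_)
    push_cast
    ring
  refine ⟨⟨gc, hgmem⟩, ⟨g, hgae⟩, ?_⟩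
  rw [dist_comm, dist_eq_norm]
  refine lt_of_le_of_lt (norm_orlicz_le (ε := ε / 2) ?_) (by push_cast; linarith)
  refine hδ' _ ?_ ?_
  · filter_upwards [hM, hgae, AEEqFun.coeFn_sub gc (f : X →ₘ[μ] ℂ)] with s h1 h2 h3
    rw [Submodule.coe_sub, h3, Pi.sub_apply, h2]
    have h4 := hgb s
    have h5 : ‖F s‖ ≤ M := by exact_mod_cast h1
    rw [← NNReal.coe_le_coe]
    push_cast
    refine (norm_sub_le _ _).trans ?_
    linarith
  · refine le_trans (le_of_eq (lintegral_congr_ae ?_)) hn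
    filter_upwards [hgae, AEEqFun.coeFn_sub gc (f : X →ₘ[μ] ℂ)] with s h2 h3
    rw [Submodule.coe_sub, h3, Pi.sub_apply, h2]

/-- A step function in an Orlicz space is bounded and vanishes off a set of finite measure. -/
theorem exists_of_mem_stepFunctions {f : orlicz Y μ} (hf : f ∈ stepFunctions Y μ) :
    ∃ (N : Set X) (M : ℝ≥0), MeasurableSet N ∧ μ N < ∞ ∧
      ∀ᵐ s ∂μ, ‖(f : X →ₘ[μ] ℂ) s‖₊ ≤ N.indicator (fun _ => M) s := by
  obtain ⟨g, hg⟩ := hf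
  obtain ⟨α, hα, hm⟩ := f.2
  obtain ⟨M, hM⟩ := g.exists_forall_norm_le
  -- A simple function has a least nonzero modulus `c`. Finiteness of the modular then bounds `Φ(αc)
  -- μ{g ≠ 0}`.
  obtain ⟨c, hc, hcg⟩ : ∃ c : ℝ≥0, 0 < c ∧ ∀ s, g s ≠ 0 → c ≤ ‖g s‖₊ := by
    by_cases hne : (g.range.filter (· ≠ 0)).Nonempty
    · obtain ⟨z, hz, hzmin⟩ := Finset.exists_min_image _ (fun z : ℂ => ‖z‖₊) hne
      refine ⟨‖z‖₊, nnnorm_pos.2 (Finset.mem_filter.1 hz).2, fun s hs => hzmin _ ?_⟩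
      exact Finset.mem_filter.2 ⟨g.mem_range_self s, hs⟩
    · refine ⟨1, one_pos, fun s hs => (hne ⟨g s, ?_⟩).elim⟩
      exact Finset.mem_filter.2 ⟨g.mem_range_self s, hs⟩
  have hN : MeasurableSet {s | g s ≠ 0} := (g.measurableSet_preimage {0}).compl
  refine ⟨{s | g s ≠ 0}, M.toNNReal, hN, ?_, ?_⟩
  · have hΦpos : 0 < Y.Φ (α * c) := by
      rw [← Y.young_left.map_zero]
      exact Y.young_left.strictMono (by positivity)
    have h1 : (Y.Φ (α * c) : ℝ≥0∞) * μ {s | g s ≠ 0} ≤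
        modular Y.Φ μ (fun s => (α : ℂ) * (f : X →ₘ[μ] ℂ) s) := by
      rw [← setLIntegral_const, ← lintegral_indicator hN]
      refine lintegral_mono_ae ?_
      filter_upwards [hg] with s hs
      by_cases h0 : g s ≠ 0
      · rw [Set.indicator_of_mem (show s ∈ {s | g s ≠ 0} from h0), hs]
        norm_cast
        refine Y.young_left.strictMono.monotone ?_
        rw [nnnorm_mul, nnnorm_coe_nnreal]
        gcongr
        exact hcg s h0
      · rw [Set.indicator_of_notMem (show s ∉ {s | g s ≠ 0} from h0)]
        exact zero_le
    by_contra htop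
    rw [not_lt, top_le_iff] at htop
    rw [htop, ENNReal.mul_top (by exact_mod_cast hΦpos.ne')] at h1
    exact absurd hm (not_lt.2 h1)
  · filter_upwards [hg] with s hs
    rw [hs]
    by_cases h0 : g s ≠ 0
    · rw [Set.indicator_of_mem (show s ∈ {s | g s ≠ 0} from h0)]
      exact NNReal.le_toNNReal_of_coe_le (hM s)
    · rw [not_not] at h0
      simp [h0]

end Orlicz

/-! ### Weights and compactly supported functions -/

section Cc

set_option linter.unusedSectionVars false

open scoped CompactlySupported Pointwise

variable {G : Type*} [AddCommGroup G] [TopologicalSpace G] [IsTopologicalAddGroup G]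
  [LocallyCompactSpace G] [T2Space G] [MeasurableSpace G] [BorelSpace G]
  {μ : Measure G} [μ.IsAddHaarMeasure] [μ.Regular]

/-- A weight is bounded on a neighbourhood of the origin. -/
theorem Weight.exists_eventually_le (ω : Weight μ) : ∃ W : ℝ, ∀ᶠ s in 𝓝 (0 : G), ω s ≤ W := by
  obtain ⟨C, hC, hsub⟩ := ω.weakly_submultiplicative
  obtain ⟨K, hK, hK0⟩ := exists_compact_mem_nhds (0 : G)
  -- A Steinhaus argument: some level set has positive measure, so differences `a - b` of its points
  -- fill a neighbourhood of `0`. The bound on `ω (-s)` serves to estimate `ω (a + (-b))`.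
  set E : ℕ → Set G := fun n => K ∩ {s | ω s ≤ n ∧ ω (-s) ≤ n} with hE
  have hU : ⋃ n, E n = K := by
    refine subset_antisymm (Set.iUnion_subset fun n => Set.inter_subset_left) fun s hs => ?_
    obtain ⟨n, hn⟩ := exists_nat_ge (max (ω s) (ω (-s)))
    exact Set.mem_iUnion.2 ⟨n, hs, (le_max_left _ _).trans hn, (le_max_right _ _).trans hn⟩
  have hpos : μ (⋃ n, E n) ≠ 0 := by
    rw [hU]
    exact (Measure.measure_pos_of_mem_nhds μ hK0).ne'
  obtain ⟨n, hn⟩ := exists_measure_pos_of_not_measure_iUnion_null hpos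
  have hneg : AEMeasurable (fun s => ω (-s)) μ :=
    ω.aemeasurable.comp_quasiMeasurePreserving (Measure.measurePreserving_neg μ).quasiMeasurePreserving
  have hnull : NullMeasurableSet (E n) μ :=
    hK.measurableSet.nullMeasurableSet.inter
      ((nullMeasurableSet_le ω.aemeasurable aemeasurable_const).inter
        (nullMeasurableSet_le hneg aemeasurable_const))
  obtain ⟨F, hFE, hF, hFae⟩ := hnull.exists_measurable_subset_ae_eq
  have hFpos : 0 < μ F := by rwa [measure_congr hFae]
  have hFfin : μ F ≠ ∞ :=
    ((measure_mono (hFE.trans Set.inter_subset_left)).trans_lt hK.measure_lt_top).ne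
  refine ⟨C * (n * n), ?_⟩
  filter_upwards [Measure.sub_mem_nhds_zero_of_addHaar_pos_ne_top μ F hF hFpos hFfin]
  rintro _ ⟨a, ha, b, hb, rfl⟩
  simp only [sub_eq_add_neg]
  refine (hsub a (-b)).trans ?_
  have h1 : ω a ≤ n := (hFE ha).2.1
  have h2 : ω (-b) ≤ n := (hFE hb).2.2
  have h3 := (ω.pos (-b)).le
  gcongr

/-- A weight is bounded on compact sets. -/
theorem Weight.exists_le_of_isCompact (ω : Weight μ) {K : Set G} (hK : IsCompact K) :
    ∃ W : ℝ≥0, ∀ s ∈ K, ω s ≤ W := by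
  obtain ⟨C, hC, hsub⟩ := ω.weakly_submultiplicative
  obtain ⟨W, hW⟩ := ω.exists_eventually_le
  refine hK.induction_on (p := fun K => ∃ W : ℝ≥0, ∀ s ∈ K, ω s ≤ W) ⟨0, by simp⟩ ?_ ?_ ?_
  · rintro s t hst ⟨W, hW⟩
    exact ⟨W, fun x hx => hW x (hst hx)⟩
  · rintro s t ⟨W, hW⟩ ⟨W', hW'⟩
    refine ⟨max W W', fun x hx => ?_⟩
    rcases hx with hx | hx
    · exact (hW x hx).trans (by simp)
    · exact (hW' x hx).trans (by simp)
  · intro x _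
    have ht : Tendsto (fun y => y - x) (𝓝 x) (𝓝 0) := by
      have : Continuous fun y : G => y - x := by fun_prop
      simpa using this.tendsto x
    -- Near `x` the weight is at most `C ω(x) ω(y - x)`, and `y - x` is near the origin.
    refine ⟨_, mem_nhdsWithin_of_mem_nhds (ht.eventually hW), (C * (ω x * W)).toNNReal, ?_⟩
    intro y hy
    have hy' : ω (y - x) ≤ W := hy
    have h1 := hsub x (y - x)
    rw [add_sub_cancel] at h1
    refine h1.trans (le_trans ?_ (Real.le_coe_toNNReal _))
    have := (ω.pos x).le
    gcongr

/-- Since `1 = ω(0) ≤ C ω(s) ω(-s)`, an upper bound for `ω` on `-K` is a lower bound for `ω` on `K`.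
-/
theorem Weight.exists_inv_le_of_isCompact (ω : Weight μ) {K : Set G} (hK : IsCompact K) :
    ∃ W : ℝ≥0, ∀ s ∈ K, (ω s)⁻¹ ≤ W := by
  obtain ⟨C, hC, hsub⟩ := ω.weakly_submultiplicative
  obtain ⟨W, hW⟩ := ω.exists_le_of_isCompact hK.neg
  refine ⟨C.toNNReal * W, fun s hs => ?_⟩
  have h1 := hsub s (-s)
  rw [add_neg_cancel, ω.map_zero] at h1
  have h2 := hW (-s) (by simpa using hs)
  have h3 := ω.pos s
  rw [NNReal.coe_mul, Real.coe_toNNReal _ hC.le, inv_le_iff_one_le_mul₀ h3]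
  calc 1 ≤ C * (ω s * ω (-s)) := h1
    _ ≤ C * (ω s * W) := by gcongr
    _ = _ := by ring

/-- The class of a compactly supported continuous function. -/
noncomputable def ccClass (μ : Measure G) : C_c(G, ℂ) →ₗ[ℂ] (G →ₘ[μ] ℂ) where
  toFun φ := AEEqFun.mk φ φ.continuous.aestronglyMeasurable
  map_add' _ _ := rfl
  map_smul' _ _ := rfl

theorem coeFn_ccClass (φ : C_c(G, ℂ)) : ccClass μ φ =ᵐ[μ] φ := AEEqFun.coeFn_mk _ _

theorem coeFn_mulWeight_ccClass (ω : Weight μ) (φ : C_c(G, ℂ)) :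
    mulWeight ω (ccClass μ φ) =ᵐ[μ] fun s => φ s * (ω s : ℂ) := by
  filter_upwards [coeFn_mulWeight ω (ccClass μ φ), coeFn_ccClass (μ := μ) φ] with s h1 h2
  rw [h1, h2]

theorem Weight.norm_coe (ω : Weight μ) (s : G) : ‖(ω s : ℂ)‖ = ω s := by
  rw [Complex.norm_real, Real.norm_of_nonneg (ω.pos s).le]

theorem exists_bound_mulWeight_ccClass (ω : Weight μ) (φ : C_c(G, ℂ)) :
    ∃ M : ℝ≥0, ∀ᵐ s ∂μ,
      ‖mulWeight ω (ccClass μ φ) s‖₊ ≤ (tsupport φ).indicator (fun _ => M) s := by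
  obtain ⟨W, hW⟩ := ω.exists_le_of_isCompact φ.hasCompactSupport.isCompact
  obtain ⟨B, hB⟩ := φ.hasCompactSupport.exists_bound_of_continuous φ.continuous
  refine ⟨B.toNNReal * W, ?_⟩
  filter_upwards [coeFn_mulWeight_ccClass ω φ] with s hs
  rw [hs]
  by_cases h : s ∈ tsupport φ
  · rw [Set.indicator_of_mem h, nnnorm_mul]
    gcongr
    · exact NNReal.le_toNNReal_of_coe_le (hB s)
    · rw [← NNReal.coe_le_coe, coe_nnnorm, ω.norm_coe]
      exact hW s h
  · rw [image_eq_zero_of_notMem_tsupport h]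
    simp

theorem lintegral_enorm_lt_top_of_le_indicator {f : G →ₘ[μ] ℂ} {N : Set G} {M : ℝ≥0}
    (hN : MeasurableSet N) (hfin : μ N < ∞)
    (h : ∀ᵐ s ∂μ, ‖f s‖₊ ≤ N.indicator (fun _ => M) s) : ∫⁻ s, ‖f s‖ₑ ∂μ < ∞ := by
  refine lt_of_le_of_lt (b := (M : ℝ≥0∞) * μ N) ?_ (ENNReal.mul_lt_top ENNReal.coe_lt_top hfin)
  rw [← setLIntegral_const, ← lintegral_indicator hN]
  refine lintegral_mono_ae ?_
  filter_upwards [h] with s hs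
  by_cases hsN : s ∈ N
  · rw [Set.indicator_of_mem hsN] at hs ⊢
    exact_mod_cast hs
  · rw [Set.indicator_of_notMem hsN] at hs ⊢
    exact (ENNReal.coe_le_coe.2 hs).trans (by simp)

theorem le_of_le_indicator {X : Type*} {N : Set X} {M : ℝ≥0} {s : X} {r : ℝ≥0}
    (h : r ≤ N.indicator (fun _ => M) s) : r ≤ M :=
  h.trans (Set.indicator_apply_le' (fun _ => le_rfl) fun _ => zero_le)

theorem ccClass_mem_weightedOrlicz (Y : YoungPair) (ω : Weight μ) (φ : C_c(G, ℂ)) :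
    ccClass μ φ ∈ weightedOrlicz Y ω := by
  obtain ⟨M, hM⟩ := exists_bound_mulWeight_ccClass ω φ
  exact mem_orlicz_of_bounded (hM.mono fun s hs => le_of_le_indicator hs)
    (lintegral_enorm_lt_top_of_le_indicator (isClosed_tsupport φ).measurableSet
      φ.hasCompactSupport.isCompact.measure_lt_top hM)

theorem ccClass_mem_weightedOrliczS (Y : YoungPair) (ω : Weight μ) (φ : C_c(G, ℂ)) :
    (⟨ccClass μ φ, ccClass_mem_weightedOrlicz Y ω φ⟩ : weightedOrlicz Y ω) ∈
      weightedOrliczS Y ω := by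
  obtain ⟨M, hM⟩ := exists_bound_mulWeight_ccClass ω φ
  exact mem_orliczS_of_bounded (hM.mono fun s hs => le_of_le_indicator hs)
    (lintegral_enorm_lt_top_of_le_indicator (isClosed_tsupport φ).measurableSet
      φ.hasCompactSupport.isCompact.measure_lt_top hM)

/-- The embedding of `C_c(G)` into `S^Φ_ω(G)`. -/
noncomputable def ccEmbed (Y : YoungPair) (ω : Weight μ) : C_c(G, ℂ) →ₗ[ℂ] weightedOrliczS Y ω where
  toFun φ := ⟨⟨ccClass μ φ, ccClass_mem_weightedOrlicz Y ω φ⟩, ccClass_mem_weightedOrliczS Y ω φ⟩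
  map_add' φ ψ := Subtype.ext (Subtype.ext (map_add (ccClass μ) φ ψ))
  map_smul' c φ := Subtype.ext (Subtype.ext (map_smul (ccClass μ) c φ))

theorem coe_ccEmbed (Y : YoungPair) (ω : Weight μ) (φ : C_c(G, ℂ)) :
    ((ccEmbed Y ω φ : weightedOrlicz Y ω) : G →ₘ[μ] ℂ) = ccClass μ φ := rfl

theorem norm_ccEmbed (Y : YoungPair) (ω : Weight μ) (φ : C_c(G, ℂ)) :
    ‖ccEmbed Y ω φ‖ = (orliczENorm Y (mulWeight ω (ccClass μ φ))).toReal := rfl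

theorem orliczENorm_ccClass_lt_top (Y : YoungPair) (ω : Weight μ) (φ : C_c(G, ℂ)) :
    orliczENorm Y (mulWeight ω (ccClass μ φ)) < ∞ :=
  orliczENorm_lt_top (ccClass_mem_weightedOrlicz Y ω φ)

theorem norm_ccEmbed_le_mul (Y : YoungPair) (ω : Weight μ) {φ ψ : C_c(G, ℂ)} (c : ℝ≥0)
    (h : ∀ s, ‖φ s‖ ≤ c * ‖ψ s‖) : ‖ccEmbed Y ω φ‖ ≤ c * ‖ccEmbed Y ω ψ‖ := by
  have h1 : orliczENorm Y (mulWeight ω (ccClass μ φ)) ≤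
      c * orliczENorm Y (mulWeight ω (ccClass μ ψ)) := by
    refine orliczENorm_le_mul c ?_
    filter_upwards [coeFn_mulWeight_ccClass ω φ, coeFn_mulWeight_ccClass ω ψ] with s h1 h2
    rw [h1, h2, norm_mul, norm_mul, ← mul_assoc]
    exact mul_le_mul_of_nonneg_right (h s) (norm_nonneg _)
  rw [norm_ccEmbed, norm_ccEmbed, ← ENNReal.coe_toReal c, ← ENNReal.toReal_mul]
  exact ENNReal.toReal_mono
    (ENNReal.mul_lt_top ENNReal.coe_lt_top (orliczENorm_ccClass_lt_top Y ω ψ)).ne h1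

theorem exists_ccBump {K : Set G} (hK : IsCompact K) :
    ∃ χ : C_c(G, ℂ), (∀ s ∈ K, χ s = 1) ∧ ∀ s, ‖χ s‖ ≤ 1 := by
  obtain ⟨f, h1, -, hc, h01⟩ := exists_continuous_one_zero_of_isCompact hK isClosed_empty
    (Set.disjoint_empty K)
  refine ⟨⟨⟨fun s => (f s : ℂ), by fun_prop⟩, hc.comp_left (g := fun x : ℝ => (x : ℂ)) (by simp)⟩,
    fun s hs => ?_, fun s => ?_⟩
  · change ((f s : ℝ) : ℂ) = 1
    rw [h1 hs]
    simp
  · change ‖((f s : ℝ) : ℂ)‖ ≤ 1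
    rw [Complex.norm_real, Real.norm_of_nonneg (h01 s).1]
    exact (h01 s).2

/-- Uniform smallness on a fixed compact set implies smallness in `S^Φ_ω(G)`. -/
theorem exists_norm_ccEmbed_le (Y : YoungPair) (ω : Weight μ) {K : Set G} (hK : IsCompact K) :
    ∃ M : ℝ≥0, ∀ (φ : C_c(G, ℂ)) (ε : ℝ≥0), (∀ s, ‖φ s‖ ≤ ε) → (∀ s ∉ K, φ s = 0) →
      ‖ccEmbed Y ω φ‖ ≤ M * ε := by
  obtain ⟨χ, hχ, -⟩ := exists_ccBump hK
  -- As `χ = 1` on `K`, the function `φ` is dominated by `ε|χ|`.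
  refine ⟨‖ccEmbed Y ω χ‖₊, fun φ ε hε hφ => ?_⟩
  rw [mul_comm]
  refine norm_ccEmbed_le_mul Y ω ε fun s => ?_
  by_cases hs : s ∈ K
  · rw [hχ s hs]
    simpa using hε s
  · rw [hφ s hs, norm_zero]
    positivity

/-! ### Translations -/

/-- The translate `s ↦ φ (s - t)`. -/
noncomputable def ccTranslate (t : G) (φ : C_c(G, ℂ)) : C_c(G, ℂ) where
  toFun s := φ (s - t)
  continuous_toFun := φ.continuous.comp (by fun_prop)
  hasCompactSupport' := φ.hasCompactSupport.comp_homeomorph (Homeomorph.subRight t)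

@[simp]
theorem ccTranslate_apply (t : G) (φ : C_c(G, ℂ)) (s : G) : ccTranslate t φ s = φ (s - t) := rfl

theorem ccTranslate_add (s t : G) (φ : C_c(G, ℂ)) :
    ccTranslate (s + t) φ = ccTranslate s (ccTranslate t φ) := by
  ext x
  simp [sub_sub]

@[simp]
theorem ccTranslate_zero (φ : C_c(G, ℂ)) : ccTranslate 0 φ = φ := by
  ext x
  simp

theorem lintegral_enorm_mul_le_orliczENorm {Y : YoungPair} {X : Type*} [MeasurableSpace X]
    {μ : Measure X} (f v : X →ₘ[μ] ℂ) (hv : modular Y.Ψ μ v ≤ 1) :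
    ∫⁻ s, ‖f s * v s‖ₑ ∂μ ≤ orliczENorm Y f :=
  le_iSup₂ (f := fun (v : X →ₘ[μ] ℂ) (_ : modular Y.Ψ μ v ≤ 1) => ∫⁻ s, ‖f s * v s‖ₑ ∂μ) v hv

/-- The substitution `s ↦ s + t` moves the translation onto the test function `v`, whose `Ψ`-modular
is unchanged by invariance of Haar measure, and onto the weight, where `ω(s + t) ≤ C ω(s) ω(t)`. -/
theorem norm_ccEmbed_translate_le (Y : YoungPair) (ω : Weight μ) {C : ℝ} (hC : 0 < C)
    (hsub : ∀ s t, ω (s + t) ≤ C * (ω s * ω t)) (t : G) (φ : C_c(G, ℂ)) :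
    ‖ccEmbed Y ω (ccTranslate t φ)‖ ≤ C * ω t * ‖ccEmbed Y ω φ‖ := by
  set c : ℝ≥0 := (C * ω t).toNNReal with hc
  have hc' : (c : ℝ) = C * ω t := Real.coe_toNNReal _ (mul_pos hC (ω.pos t)).le
  have h1 : orliczENorm Y (mulWeight ω (ccClass μ (ccTranslate t φ))) ≤
      c * orliczENorm Y (mulWeight ω (ccClass μ φ)) := by
    refine iSup₂_le fun v hv => ?_
    have hmp : MeasurePreserving (fun s : G => s + t) μ μ := measurePreserving_add_right μ t
    set v' : G →ₘ[μ] ℂ := v.compMeasurePreserving _ hmp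
    have hv'ae : v' =ᵐ[μ] fun s => v (s + t) := AEEqFun.coeFn_compMeasurePreserving v hmp
    have hv' : modular Y.Ψ μ v' ≤ 1 := by
      refine le_trans (le_of_eq ?_) hv
      unfold modular
      rw [← lintegral_add_right_eq_self (fun s => (Y.Ψ ‖v s‖₊ : ℝ≥0∞)) t]
      refine lintegral_congr_ae ?_
      filter_upwards [hv'ae] with s hs
      rw [hs]
    refine le_trans ?_ (mul_le_mul_right (lintegral_enorm_mul_le_orliczENorm _ v' hv') _)
    rw [← lintegral_const_mul' _ _ ENNReal.coe_ne_top]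
    calc ∫⁻ s, ‖mulWeight ω (ccClass μ (ccTranslate t φ)) s * v s‖ₑ ∂μ
        = ∫⁻ s, ‖φ (s - t) * (ω s : ℂ) * v s‖ₑ ∂μ := by
          refine lintegral_congr_ae ?_
          filter_upwards [coeFn_mulWeight_ccClass ω (ccTranslate t φ)] with s hs
          rw [hs, ccTranslate_apply]
      _ = ∫⁻ s, ‖φ s * (ω (s + t) : ℂ) * v (s + t)‖ₑ ∂μ := by
          rw [← lintegral_add_right_eq_self _ t]
          simp
      _ ≤ _ := by
          refine lintegral_mono_ae ?_
          filter_upwards [coeFn_mulWeight_ccClass ω φ, hv'ae] with s h1 h2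
          rw [h1, h2, enorm_mul, enorm_mul, enorm_mul, enorm_mul, ← mul_assoc, mul_left_comm]
          gcongr
          rw [enorm_eq_nnnorm, enorm_eq_nnnorm]
          norm_cast
          rw [← NNReal.coe_le_coe]
          push_cast
          rw [hc', Real.norm_of_nonneg (ω.pos _).le, Real.norm_of_nonneg (ω.pos _).le]
          refine (hsub s t).trans (le_of_eq ?_)
          ring
  rw [norm_ccEmbed, norm_ccEmbed, ← hc', ← ENNReal.coe_toReal c, ← ENNReal.toReal_mul]
  exact ENNReal.toReal_mono
    (ENNReal.mul_lt_top ENNReal.coe_lt_top (orliczENorm_ccClass_lt_top Y ω φ)).ne h1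

/-- Translation of a compactly supported function is continuous for uniform convergence, and the
supports stay locally in a compact set. -/
theorem exists_isCompact_eventually_translate (φ : C_c(G, ℂ)) (t₀ : G) :
    ∃ K : Set G, IsCompact K ∧ ∀ ε > 0, ∀ᶠ t in 𝓝 t₀,
      (∀ s ∉ K, ccTranslate t φ s = 0) ∧ (∀ s, ‖ccTranslate t φ s - ccTranslate t₀ φ s‖ < ε) := by
  obtain ⟨N, hN, hN0⟩ := exists_compact_mem_nhds t₀
  have hK : IsCompact (tsupport φ + N) := φ.hasCompactSupport.isCompact.add hN
  have hvan : ∀ t ∈ N, ∀ s ∉ tsupport φ + N, ccTranslate t φ s = 0 := fun t ht s hs => by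
    rw [ccTranslate_apply]
    refine image_eq_zero_of_notMem_tsupport fun h => hs ?_
    exact ⟨s - t, h, t, ht, by simp⟩
  refine ⟨tsupport φ + N, hK, fun ε hε => ?_⟩
  -- Compactness makes the joint continuity in `(t, s)` uniform in `s`.
  have hc : ∀ᶠ t in 𝓝 t₀, ∀ s ∈ tsupport φ + N,
      ‖ccTranslate t φ s - ccTranslate t₀ φ s‖ < ε := by
    refine hK.eventually_forall_of_forall_eventually fun s _ => ?_
    have hcont : Continuous fun z : G × G => ‖φ (z.2 - z.1) - φ (z.2 - t₀)‖ :=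
      ((φ.continuous.comp (by fun_prop)).sub (φ.continuous.comp (by fun_prop))).norm
    refine hcont.tendsto (t₀, s) |>.eventually (gt_mem_nhds ?_)
    simpa using hε
  filter_upwards [hN0, hc] with t ht h
  refine ⟨hvan t ht, fun s => ?_⟩
  by_cases hs : s ∈ tsupport φ + N
  · exact h s hs
  · rw [hvan t ht s hs, hvan t₀ (mem_of_mem_nhds hN0) s hs]
    simpa using hε

theorem continuous_ccEmbed_translate (Y : YoungPair) (ω : Weight μ) (φ : C_c(G, ℂ)) :
    Continuous fun t => ccEmbed Y ω (ccTranslate t φ) := by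
  rw [continuous_iff_continuousAt]
  intro t₀
  obtain ⟨K, hK, h⟩ := exists_isCompact_eventually_translate φ t₀
  obtain ⟨M, hM⟩ := exists_norm_ccEmbed_le Y ω hK
  rw [ContinuousAt, Metric.tendsto_nhds]
  intro ε hε
  set δ : ℝ≥0 := ε.toNNReal / (M + 1) with hδ
  have hε' : (ε.toNNReal : ℝ) = ε := Real.coe_toNNReal _ hε.le
  have hδ0 : 0 < δ := by
    have : 0 < ε.toNNReal := Real.toNNReal_pos.2 hε
    positivity
  -- An eventual statement near `t₀` holds at `t₀`; the value `1` is immaterial for the support.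
  have hvan := (h 1 one_pos).self_of_nhds.1
  filter_upwards [h δ (by exact_mod_cast hδ0)] with t ht
  rw [dist_eq_norm, ← map_sub]
  refine lt_of_le_of_lt (hM _ δ (fun s => (ht.2 s).le) fun s hs => ?_) ?_
  · rw [CompactlySupportedContinuousMap.sub_apply, ht.1 s hs, hvan s hs, sub_zero]
  · rw [hδ, NNReal.coe_div, hε', mul_div_assoc', div_lt_iff₀ (by positivity), mul_comm]
    push_cast
    gcongr
    linarith

/-! ### Density of `C_c(G)` -/

/-- Density of `C_c(X)` in `L¹` for regular measures on locally compact Hausdorff spaces. -/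
theorem exists_continuous_lintegral_enorm_sub_le {X : Type*} [TopologicalSpace X] [T2Space X]
    [LocallyCompactSpace X] [MeasurableSpace X] [BorelSpace X] {μ : Measure X} [μ.Regular]
    {f : X → ℂ} (hf : Integrable f μ) {ε : ℝ≥0∞} (hε : ε ≠ 0) :
    ∃ g : X → ℂ, ∫⁻ x, ‖f x - g x‖ₑ ∂μ ≤ ε ∧ Continuous g := by
  simp only [← memLp_one_iff_integrable] at hf
  suffices h : ∃ g : X → ℂ, eLpNorm (f - g) 1 μ ≤ ε ∧ Continuous g by
    simpa only [eLpNorm_one_eq_lintegral_enorm, Pi.sub_apply] using h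
  refine hf.induction_dense ENNReal.one_ne_top _ (fun c t ht htμ ε hε => ?_)
    (fun f g => Continuous.add) (fun f => Continuous.aestronglyMeasurable) hε
  obtain ⟨η, ηpos, hη⟩ := exists_eLpNorm_indicator_le (μ := μ) ENNReal.one_ne_top c hε
  have hη2 : ((η / 2 : ℝ≥0) : ℝ≥0∞) ≠ 0 := by
    have : 0 < η / 2 := by positivity
    exact_mod_cast this.ne'
  -- Inner regularity is used for `t` and outer regularity only for the compact `K`. A Urysohn
  -- function for `K ⊆ U` differs from the indicator of `t` only on `(U \ K) ∪ (t \ K)`, by at most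
  -- `1`.
  obtain ⟨K, hKt, hK, hKη⟩ := ht.exists_isCompact_sdiff_lt htμ.ne hη2
  obtain ⟨U, hKU, hU, -, hUη⟩ :=
    hK.measurableSet.exists_isOpen_sdiff_lt (μ := μ) hK.measure_lt_top.ne hη2
  obtain ⟨g, hg1, hg0, -, hg01⟩ := exists_continuous_one_zero_of_isCompact hK hU.isClosed_compl
    (Set.disjoint_compl_right_iff_subset.2 hKU)
  refine ⟨fun x => (g x : ℂ) * c, (eLpNorm_mono fun x => ?_).trans
    (hη ((U \ K) ∪ (t \ K)) ?_), by fun_prop⟩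
  · simp only [Pi.sub_apply]
    by_cases hxK : x ∈ K
    · have h1 : g x = 1 := hg1 hxK
      simp [h1, hKt hxK]
    · by_cases hx : x ∈ (U \ K) ∪ (t \ K)
      · rw [Set.indicator_of_mem hx]
        by_cases hxt : x ∈ t
        · rw [Set.indicator_of_mem hxt]
          have h2 : (g x : ℂ) * c - c = -(((1 - g x : ℝ) : ℂ) * c) := by push_cast; ring
          rw [h2, norm_neg, norm_mul, Complex.norm_real,
            Real.norm_of_nonneg (by linarith [(hg01 x).2])]
          exact mul_le_of_le_one_left (norm_nonneg _) (by linarith [(hg01 x).1])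
        · rw [Set.indicator_of_notMem hxt, sub_zero, norm_mul, Complex.norm_real,
            Real.norm_of_nonneg (hg01 x).1]
          exact mul_le_of_le_one_left (norm_nonneg _) (hg01 x).2
      · have hxU : x ∉ U := fun h => hx (Or.inl ⟨h, hxK⟩)
        have hxt : x ∉ t := fun h => hx (Or.inr ⟨h, hxK⟩)
        have h1 : g x = 0 := hg0 hxU
        simp [h1, hxt]
  · calc μ ((U \ K) ∪ (t \ K)) ≤ μ (U \ K) + μ (t \ K) := measure_union_le _ _
      _ ≤ ((η / 2 : ℝ≥0) : ℝ≥0∞) + ((η / 2 : ℝ≥0) : ℝ≥0∞) := add_le_add hUη.le hKη.le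
      _ = η := by norm_cast; exact add_halves η

/-- One `ε` pays for cutting `f` down to a compact `K`, the other for approximating `b = 1_K f / ω`
by some `φ` in `C_c(G)`. Both errors are small in `L¹` and uniformly bounded, hence small in the
Orlicz norm. -/
theorem exists_orliczENorm_sub_ccClass_le (Y : YoungPair) (ω : Weight μ) {f : orlicz Y μ}
    (hf : f ∈ stepFunctions Y μ) {ε : ℝ≥0} (hε : 0 < ε) :
    ∃ φ : C_c(G, ℂ),
      orliczENorm Y ((f : G →ₘ[μ] ℂ) - mulWeight ω (ccClass μ φ)) ≤ ε + ε := by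
  obtain ⟨N, M, hN, hNfin, hfM⟩ := exists_of_mem_stepFunctions hf
  obtain ⟨δ₁, hδ₁, hsmall₁⟩ := exists_orliczENorm_le (μ := μ) Y M hε
  obtain ⟨K, hKN, hK, hKδ⟩ := hN.exists_isCompact_sdiff_lt hNfin.ne
    (ε := ((δ₁ / (M + 1) : ℝ≥0) : ℝ≥0∞)) (by
      have : 0 < δ₁ / (M + 1) := by positivity
      exact_mod_cast this.ne')
  obtain ⟨W', hW'⟩ := ω.exists_inv_le_of_isCompact hK
  obtain ⟨χ, hχ, hχ1⟩ := exists_ccBump hK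
  obtain ⟨W, hW⟩ := ω.exists_le_of_isCompact χ.hasCompactSupport.isCompact
  set R : ℝ≥0 := M * W' + 1 with hR
  have hR0 : 0 < R := by positivity
  obtain ⟨δ₂, hδ₂, hsmall₂⟩ := exists_orliczENorm_le (μ := μ) Y (2 * R * W) hε
  set F : G → ℂ := ((f : G →ₘ[μ] ℂ) : G → ℂ) with hF
  set b : G → ℂ := K.indicator fun s => F s * ((ω s)⁻¹ : ℝ) with hb
  have hbm : AEStronglyMeasurable b μ := by
    refine AEStronglyMeasurable.indicator ?_ hK.measurableSet
    exact (f : G →ₘ[μ] ℂ).aestronglyMeasurable.mul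
      (Complex.measurable_ofReal.comp_aemeasurable ω.aemeasurable.inv).aestronglyMeasurable
  have hbR : ∀ᵐ s ∂μ, ‖b s‖ ≤ K.indicator (fun _ => (R : ℝ)) s := by
    filter_upwards [hfM] with s hs
    by_cases h : s ∈ K
    · simp only [hb, Set.indicator_of_mem h]
      have h1 : ‖F s‖ ≤ M := by exact_mod_cast le_of_le_indicator hs
      have h2 := hW' s h
      rw [norm_mul, Complex.norm_real, Real.norm_of_nonneg (inv_nonneg.2 (ω.pos s).le)]
      calc ‖F s‖ * (ω s)⁻¹ ≤ M * W' := by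
            have := inv_nonneg.2 (ω.pos s).le
            gcongr
        _ ≤ R := by rw [hR]; push_cast; linarith
    · simp [hb, h]
  have hbi : Integrable b μ := by
    refine Integrable.mono' ?_ hbm hbR
    exact (integrable_indicator_iff hK.measurableSet).2
      (integrableOn_const hK.measure_lt_top.ne)
  obtain ⟨φ₀, hφ₀, hφc⟩ := exists_continuous_lintegral_enorm_sub_le hbi
    (ε := ((δ₂ / (2 * W + 1) : ℝ≥0) : ℝ≥0∞)) (by
      have : 0 < δ₂ / (2 * W + 1) := by positivity
      exact_mod_cast this.ne')
  -- The radial retraction onto the disc of radius `R`, which contains almost every value of `b`. It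
  -- makes the approximant bounded and at most doubles its distance to `b`.
  set r : ℂ → ℂ := fun z => (((R : ℝ) / max (R : ℝ) ‖z‖ : ℝ) : ℂ) * z with hr
  have hmax : ∀ z : ℂ, 0 < max (R : ℝ) ‖z‖ := fun z => lt_max_of_lt_left (by exact_mod_cast hR0)
  have hrc : Continuous r := by
    refine Continuous.mul (Complex.continuous_ofReal.comp ?_) continuous_id
    exact continuous_const.div (continuous_const.max continuous_norm) fun z => (hmax z).ne'
  have hrn : ∀ z, ‖r z‖ = (R : ℝ) / max (R : ℝ) ‖z‖ * ‖z‖ := fun z => by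
    rw [hr, norm_mul, Complex.norm_real, Real.norm_of_nonneg (div_nonneg R.coe_nonneg (hmax z).le)]
  have hrz : ∀ z, ‖r z‖ ≤ ‖z‖ := fun z => by
    rw [hrn]
    refine mul_le_of_le_one_left (norm_nonneg _) ?_
    rw [div_le_one (hmax z)]
    exact le_max_left _ _
  have hrR : ∀ z, ‖r z‖ ≤ R := fun z => by
    rw [hrn, div_mul_eq_mul_div, div_le_iff₀ (hmax z)]
    gcongr
    exact le_max_right _ _
  have hrsub : ∀ z w : ℂ, ‖w‖ ≤ R → ‖w - r z‖ ≤ 2 * ‖w - z‖ := fun z w hw => by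
    have h1 : ‖z - r z‖ ≤ ‖w - z‖ := by
      rcases le_total ‖z‖ (R : ℝ) with h | h
      · have : r z = z := by
          simp only [hr, max_eq_left h]
          rw [div_self (by exact_mod_cast hR0.ne')]
          simp
        rw [this, sub_self, norm_zero]
        positivity
      · have hz : 0 < ‖z‖ := lt_of_lt_of_le (by exact_mod_cast hR0) h
        have h2 : z - r z = ((1 - R / ‖z‖ : ℝ) : ℂ) * z := by
          simp only [hr, max_eq_right h]
          push_cast
          ring
        have h3 : (R : ℝ) / ‖z‖ ≤ 1 := (div_le_one hz).2 h
        rw [h2, norm_mul, Complex.norm_real, Real.norm_of_nonneg (by linarith), sub_mul, one_mul,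
          div_mul_cancel₀ _ hz.ne']
        have h4 := norm_sub_norm_le z w
        rw [norm_sub_rev] at h4
        linarith
    calc ‖w - r z‖ = ‖(w - z) + (z - r z)‖ := by congr 1; ring
      _ ≤ ‖w - z‖ + ‖z - r z‖ := norm_add_le _ _
      _ ≤ _ := by linarith
  -- The bump `χ` is `1` on `K`, so nothing changes there, and it confines the error to a compact
  -- set where `ω ≤ W`.
  let φ : C_c(G, ℂ) := ⟨⟨fun s => χ s * r (φ₀ s), χ.continuous.mul (hrc.comp hφc)⟩,
    χ.hasCompactSupport.mul_right⟩
  have hφ : ∀ s, φ s = χ s * r (φ₀ s) := fun s => rfl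
  have hφr : ∀ s, ‖φ s‖ ≤ ‖r (φ₀ s)‖ := fun s => by
    rw [hφ, norm_mul]
    exact mul_le_of_le_one_left (norm_nonneg _) (hχ1 s)
  have hbφ : ∀ᵐ s ∂μ, ‖b s - φ s‖ ≤ 2 * ‖b s - φ₀ s‖ ∧ ‖b s - φ s‖ ≤ 2 * R ∧
      (s ∉ tsupport χ → b s - φ s = 0) := by
    filter_upwards [hbR] with s hs
    have hb0 : s ∉ K → b s = 0 := fun h => by simp [hb, h]
    have hbs : ‖b s‖ ≤ R := by
      by_cases h : s ∈ K
      · simpa [h] using hs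
      · simp [hb0 h]
    refine ⟨?_, ?_, ?_⟩
    · by_cases h : s ∈ K
      · rw [hφ, hχ s h, one_mul]
        exact hrsub _ _ hbs
      · rw [hb0 h, zero_sub, zero_sub, norm_neg, norm_neg]
        refine ((hφr s).trans (hrz _)).trans ?_
        linarith [norm_nonneg (φ₀ s)]
    · refine (norm_sub_le _ _).trans ?_
      linarith [(hφr s).trans (hrR _)]
    · intro h
      have hχ0 : χ s = 0 := image_eq_zero_of_notMem_tsupport h
      have hsK : s ∉ K := fun h' => by simp [hχ s h'] at hχ0
      rw [hφ, hχ0, hb0 hsK]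
      simp
  let u : G →ₘ[μ] ℂ := AEEqFun.mk (K.indicator F)
    ((f : G →ₘ[μ] ℂ).aestronglyMeasurable.indicator hK.measurableSet)
  have hu : u =ᵐ[μ] K.indicator F := AEEqFun.coeFn_mk _ _
  have hkey : ∀ᵐ s ∂μ,
      ‖(u - mulWeight ω (ccClass μ φ) : G →ₘ[μ] ℂ) s‖ ≤ 2 * W * ‖b s - φ₀ s‖ ∧
      ‖(u - mulWeight ω (ccClass μ φ) : G →ₘ[μ] ℂ) s‖ ≤ 2 * R * W := by
    filter_upwards [hbφ, hu, AEEqFun.coeFn_sub u (mulWeight ω (ccClass μ φ)),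
      coeFn_mulWeight_ccClass ω φ] with s ⟨h1, h1', h1''⟩ h2 h3 h4
    have hω : (ω s : ℂ) ≠ 0 := by exact_mod_cast (ω.pos s).ne'
    have h5 : K.indicator F s - φ s * (ω s : ℂ) = (b s - φ s) * ω s := by
      by_cases h : s ∈ K
      · simp only [hb, Set.indicator_of_mem h]
        push_cast
        field_simp
      · simp [hb, h]
    rw [h3, Pi.sub_apply, h2, h4, h5, norm_mul, ω.norm_coe]
    by_cases h : s ∈ tsupport χ
    · have hWs := hW s h
      have hpos := (ω.pos s).le
      constructor
      · calc ‖b s - φ s‖ * ω s ≤ (2 * ‖b s - φ₀ s‖) * W := by gcongr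
          _ = _ := by ring
      · gcongr
    · rw [h1'' h, norm_zero, zero_mul]
      constructor <;> positivity
  refine ⟨φ, ?_⟩
  have hsplit : (f : G →ₘ[μ] ℂ) - mulWeight ω (ccClass μ φ) =
      ((f : G →ₘ[μ] ℂ) - u) + (u - mulWeight ω (ccClass μ φ)) := by abel
  rw [hsplit]
  refine (orliczENorm_add_le _ _).trans (add_le_add (hsmall₁ _ ?_ ?_) (hsmall₂ _ ?_ ?_))
  · filter_upwards [hfM, hu, AEEqFun.coeFn_sub (f : G →ₘ[μ] ℂ) u] with s h1 h2 h3
    rw [h3, Pi.sub_apply, h2]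
    by_cases h : s ∈ K
    · simp [h, hF]
    · simpa [h] using le_of_le_indicator h1
  · calc ∫⁻ s, ‖((f : G →ₘ[μ] ℂ) - u : G →ₘ[μ] ℂ) s‖ₑ ∂μ
        ≤ ∫⁻ s, (N \ K).indicator (fun _ => (M : ℝ≥0∞)) s ∂μ := by
          refine lintegral_mono_ae ?_
          filter_upwards [hfM, hu, AEEqFun.coeFn_sub (f : G →ₘ[μ] ℂ) u] with s h1 h2 h3
          rw [h3, Pi.sub_apply, h2]
          by_cases h : s ∈ K
          · simp [h, hF]
          · by_cases h' : s ∈ N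
            · rw [Set.indicator_of_mem h'] at h1
              simp only [Set.indicator_of_notMem h, sub_zero,
                Set.indicator_of_mem (show s ∈ N \ K from ⟨h', h⟩)]
              exact_mod_cast h1
            · rw [Set.indicator_of_notMem h'] at h1
              simp only [Set.indicator_of_notMem h, sub_zero]
              exact (ENNReal.coe_le_coe.2 h1).trans (by simp)
      _ = M * μ (N \ K) := by
          rw [lintegral_indicator (hN.diff hK.measurableSet), setLIntegral_const]
      _ ≤ M * ((δ₁ / (M + 1) : ℝ≥0) : ℝ≥0∞) := by gcongr
      _ ≤ δ₁ := by
          norm_cast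
          rw [mul_div_assoc', div_le_iff₀ (by positivity), mul_comm]
          gcongr
          simp
  · filter_upwards [hkey] with s hs
    exact (NNReal.coe_le_coe.1 (by push_cast; exact hs.2))
  · calc ∫⁻ s, ‖(u - mulWeight ω (ccClass μ φ) : G →ₘ[μ] ℂ) s‖ₑ ∂μ
        ≤ ∫⁻ s, ((2 * W : ℝ≥0) : ℝ≥0∞) * ‖b s - φ₀ s‖ₑ ∂μ := by
          refine lintegral_mono_ae ?_
          filter_upwards [hkey] with s hs
          rw [enorm_eq_nnnorm, enorm_eq_nnnorm]
          norm_cast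
          exact (NNReal.coe_le_coe.1 (by push_cast; exact hs.1))
      _ = ((2 * W : ℝ≥0) : ℝ≥0∞) * ∫⁻ s, ‖b s - φ₀ s‖ₑ ∂μ :=
          lintegral_const_mul' _ _ ENNReal.coe_ne_top
      _ ≤ ((2 * W : ℝ≥0) : ℝ≥0∞) * ((δ₂ / (2 * W + 1) : ℝ≥0) : ℝ≥0∞) := by gcongr
      _ ≤ δ₂ := by
          norm_cast
          rw [mul_div_assoc', div_le_iff₀ (by positivity), mul_comm]
          gcongr
          simp

theorem denseRange_ccEmbed (Y : YoungPair) (ω : Weight μ) : DenseRange (ccEmbed Y ω) := by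
  intro a
  rw [Metric.mem_closure_iff]
  intro ε hε
  have ha : toOrlicz Y ω a ∈ (stepFunctions Y μ).topologicalClosure := a.2
  rw [← SetLike.mem_coe, Submodule.topologicalClosure_coe, Metric.mem_closure_iff] at ha
  obtain ⟨f, hf, hfa⟩ := ha (ε / 2) (by positivity)
  -- The approximation costs twice this amount, and `ε/2 + 2ε/5 < ε`.
  have hε5 : 0 < (ε / 5).toNNReal := Real.toNNReal_pos.2 (by positivity)
  obtain ⟨φ, hφ⟩ := exists_orliczENorm_sub_ccClass_le Y ω hf hε5
  refine ⟨_, ⟨φ, rfl⟩, ?_⟩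
  have h1 : dist f (toOrlicz Y ω (ccEmbed Y ω φ)) ≤ ((ε / 5).toNNReal + (ε / 5).toNNReal : ℝ≥0) := by
    rw [dist_eq_norm]
    exact norm_orlicz_le (by exact_mod_cast hφ)
  rw [NNReal.coe_add, Real.coe_toNNReal _ (by positivity)] at h1
  have h2 : dist a (ccEmbed Y ω φ) = dist (toOrlicz Y ω a) (toOrlicz Y ω (ccEmbed Y ω φ)) := rfl
  rw [h2]
  refine lt_of_le_of_lt (dist_triangle _ f _) ?_
  linarith

end Cc

/-! ### Convolution of compactly supported functions -/

section Convolution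

set_option linter.unusedSectionVars false

open scoped CompactlySupported Pointwise BoundedContinuousFunction

variable {G : Type*} [AddCommGroup G] [TopologicalSpace G] [IsTopologicalAddGroup G]
  [LocallyCompactSpace G] [T2Space G] [MeasurableSpace G] [BorelSpace G]
  {μ : Measure G} [μ.IsAddHaarMeasure] [μ.Regular]

variable (μ) in
/-- Convolution on `C_c(G)`. -/
noncomputable def ccConv (φ ψ : C_c(G, ℂ)) : C_c(G, ℂ) where
  toFun := φ ⋆[ContinuousLinearMap.mul ℂ ℂ, μ] ψ
  continuous_toFun := ψ.hasCompactSupport.continuous_convolution_right _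
    φ.continuous.locallyIntegrable ψ.continuous
  hasCompactSupport' := φ.hasCompactSupport.convolution _ ψ.hasCompactSupport

theorem coe_ccConv (φ ψ : C_c(G, ℂ)) :
    ⇑(ccConv μ φ ψ) = φ ⋆[ContinuousLinearMap.mul ℂ ℂ, μ] ψ := rfl

theorem ccConv_apply (φ ψ : C_c(G, ℂ)) (x : G) :
    ccConv μ φ ψ x = ∫ t, φ t * ψ (x - t) ∂μ := rfl

theorem ccConv_comm (φ ψ : C_c(G, ℂ)) : ccConv μ φ ψ = ccConv μ ψ φ := by
  ext x
  have h := convolution_flip (L := ContinuousLinearMap.mul ℂ ℂ) (f := φ) (g := ψ) (μ := μ)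
  rw [ContinuousLinearMap.flip_mul] at h
  rw [coe_ccConv, coe_ccConv, h]

theorem ccConv_translate_left (t : G) (φ ψ : C_c(G, ℂ)) :
    ccConv μ (ccTranslate t φ) ψ = ccTranslate t (ccConv μ φ ψ) := by
  ext x
  rw [ccTranslate_apply, ccConv_apply, ccConv_apply,
    ← integral_sub_right_eq_self (fun s => φ s * ψ (x - t - s)) t]
  simp

theorem ccConv_translate_right (t : G) (φ ψ : C_c(G, ℂ)) :
    ccConv μ φ (ccTranslate t ψ) = ccTranslate t (ccConv μ φ ψ) := by
  rw [ccConv_comm, ccConv_translate_left, ccConv_comm]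

theorem convolution_congr_ae {f f' g g' : G → ℂ} (hf : f =ᵐ[μ] f') (hg : g =ᵐ[μ] g') :
    f ⋆[ContinuousLinearMap.mul ℂ ℂ, μ] g = f' ⋆[ContinuousLinearMap.mul ℂ ℂ, μ] g' := by
  ext x
  refine integral_congr_ae ?_
  filter_upwards [hf, (Measure.measurePreserving_sub_left μ x).quasiMeasurePreserving.ae hg] with t h1 h2
  rw [h1, h2]

/-! ### The multiplication on `S^Φ_ω(G)` -/

variable {Y : YoungPair} {ω : Weight μ}

theorem mul_ccEmbed_eq {m : BoundedMul (weightedOrlicz Y ω)}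
    (hm : m.IsConvolution (fun f => (f : G →ₘ[μ] ℂ))) (φ ψ : C_c(G, ℂ)) :
    m.mul (ccEmbed Y ω φ) (ccEmbed Y ω ψ) = ccEmbed Y ω (ccConv μ φ ψ) := by
  refine Subtype.ext (AEEqFun.ext ?_)
  refine (hm _ _).2.trans ?_
  simp only [coe_ccEmbed]
  rw [convolution_congr_ae (coeFn_ccClass φ) (coeFn_ccClass ψ)]
  exact (coeFn_ccClass (μ := μ) (ccConv μ φ ψ)).symm

theorem isClosed_weightedOrliczS (Y : YoungPair) (ω : Weight μ) :
    IsClosed (weightedOrliczS Y ω : Set (weightedOrlicz Y ω)) := by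
  have hiso : Isometry (toOrlicz Y ω) := AddMonoidHomClass.isometry_of_norm _ fun _ => rfl
  exact (Submodule.isClosed_topologicalClosure (stepFunctions Y μ)).preimage hiso.continuous

/-- The product is jointly continuous, `S^Φ_ω(G)` is closed, and on the dense subspace `C_c(G)`
convolution stays in `C_c(G)`. -/
theorem mul_mem_weightedOrliczS {m : BoundedMul (weightedOrlicz Y ω)}
    (hm : m.IsConvolution (fun f => (f : G →ₘ[μ] ℂ))) (a b : weightedOrliczS Y ω) :
    m.mul a b ∈ weightedOrliczS Y ω := by
  refine (denseRange_ccEmbed Y ω).induction_on₂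
    (p := fun a b : weightedOrliczS Y ω => m.mul a b ∈ weightedOrliczS Y ω) ?_ ?_ a b
  · refine (isClosed_weightedOrliczS Y ω).preimage (f := fun q :
      weightedOrliczS Y ω × weightedOrliczS Y ω => m.mul q.1 q.2) ?_
    exact (m.mul.continuous.comp (continuous_subtype_val.comp continuous_fst)).clm_apply
      (continuous_subtype_val.comp continuous_snd)
  · intro φ ψ
    rw [mul_ccEmbed_eq hm]
    exact (ccEmbed Y ω _).2

/-- The restriction of the convolution product to `S^Φ_ω(G)`. -/
noncomputable def restrictMul {m : BoundedMul (weightedOrlicz Y ω)}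
    (hm : m.IsConvolution (fun f => (f : G →ₘ[μ] ℂ))) : BoundedMul (weightedOrliczS Y ω) where
  mul := LinearMap.mkContinuous₂
    (LinearMap.mk₂ ℂ (fun a b => ⟨m.mul a b, mul_mem_weightedOrliczS hm a b⟩)
      (fun a a' b => Subtype.ext (by simp))
      (fun c a b => Subtype.ext (by simp))
      (fun a b b' => Subtype.ext (by simp))
      (fun c a b => Subtype.ext (by simp))) ‖m.mul‖ fun a b => m.mul.le_opNorm₂ a b
  assoc a b c := Subtype.ext (m.assoc a b c)

theorem isConvolution_restrictMul {m : BoundedMul (weightedOrlicz Y ω)}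
    (hm : m.IsConvolution (fun f => (f : G →ₘ[μ] ℂ))) :
    (restrictMul hm).IsConvolution (fun f => ((f : weightedOrlicz Y ω) : G →ₘ[μ] ℂ)) :=
  fun f g => hm f g

theorem restrictMul_ccEmbed {m : BoundedMul (weightedOrlicz Y ω)}
    (hm : m.IsConvolution (fun f => (f : G →ₘ[μ] ℂ))) (φ ψ : C_c(G, ℂ)) :
    (restrictMul hm).mul (ccEmbed Y ω φ) (ccEmbed Y ω ψ) = ccEmbed Y ω (ccConv μ φ ψ) :=
  Subtype.ext (mul_ccEmbed_eq hm φ ψ)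

/-! ### Approximate identities -/

/-- A normalised bump `e` near `0` averages translates of `φ` that are uniformly close to `φ` and
live on one compact set. As `e` may depend on `φ`, no norm bound on it is needed. -/
theorem exists_ccEmbed_conv_sub_le (Y : YoungPair) (ω : Weight μ) (φ : C_c(G, ℂ)) {ε : ℝ}
    (hε : 0 < ε) : ∃ e : C_c(G, ℂ), ‖ccEmbed Y ω (ccConv μ e φ) - ccEmbed Y ω φ‖ ≤ ε := by
  obtain ⟨K, hK, h⟩ := exists_isCompact_eventually_translate φ 0
  obtain ⟨M, hM⟩ := exists_norm_ccEmbed_le Y ω hK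
  set δ : ℝ≥0 := ε.toNNReal / (M + 1) with hδ
  have hε' : (ε.toNNReal : ℝ) = ε := Real.coe_toNNReal _ hε.le
  have hδ0 : 0 < δ := by
    have : 0 < ε.toNNReal := Real.toNNReal_pos.2 hε
    positivity
  have hMδ : M * δ ≤ ε := by
    rw [hδ, NNReal.coe_div, hε', mul_div_assoc', div_le_iff₀ (by positivity), mul_comm]
    push_cast
    gcongr
    linarith
  obtain ⟨V, hVh, hV, h0V⟩ := eventually_nhds_iff.1 (h δ (by exact_mod_cast hδ0))
  obtain ⟨e₀, he1, he0, hec, he01⟩ := exists_continuous_one_zero_of_isCompact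
    (isCompact_singleton (x := (0 : G))) hV.isClosed_compl (by simpa using h0V)
  have hpos : 0 < ∫ t, e₀ t ∂μ := by
    refine e₀.continuous.integral_pos_of_hasCompactSupport_nonneg_nonzero hec
      (fun t => (he01 t).1) (x := 0) ?_
    rw [he1 rfl]
    exact one_ne_zero
  set I : ℝ := ∫ t, e₀ t ∂μ with hI
  let e : C_c(G, ℂ) := ⟨⟨fun s => ((e₀ s / I : ℝ) : ℂ), by fun_prop⟩,
    hec.comp_left (g := fun x : ℝ => ((x / I : ℝ) : ℂ)) (by simp)⟩
  have he : ∀ t, e t = ((e₀ t / I : ℝ) : ℂ) := fun t => rfl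
  have heV : ∀ t ∉ V, e t = 0 := fun t ht => by
    have : e₀ t = 0 := he0 ht
    rw [he, this]
    simp
  have hei : Integrable e μ := e.continuous.integrable_of_hasCompactSupport e.hasCompactSupport
  have hint : ∫ t, e t ∂μ = 1 := by
    simp only [he]
    rw [integral_complex_ofReal, integral_div, div_self hpos.ne']
    simp
  have hnorm : ∫ t, ‖e t‖ ∂μ = 1 := by
    have : ∀ t, ‖e t‖ = e₀ t / I := fun t => by
      rw [he, Complex.norm_real, Real.norm_of_nonneg (div_nonneg (he01 t).1 hpos.le)]
    simp only [this]
    rw [integral_div, div_self hpos.ne']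
  have hφK : ∀ s ∉ K, φ s = 0 := fun s hs => by
    simpa using (hVh 0 h0V).1 s hs
  refine ⟨e, ?_⟩
  rw [← map_sub]
  refine (hM _ δ (fun x => ?_) fun x hx => ?_).trans hMδ
  · have hci : Integrable (fun t => e t * φ (x - t)) μ :=
      (φ.hasCompactSupport.convolutionExists_right (ContinuousLinearMap.mul ℂ ℂ)
        e.continuous.locallyIntegrable φ.continuous) x
    have hsub : (ccConv μ e φ - φ) x = ∫ t, e t * (φ (x - t) - φ x) ∂μ := by
      simp only [mul_sub]
      rw [integral_sub hci (hei.mul_const _), integral_mul_const, hint, one_mul]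
      rfl
    rw [hsub]
    calc ‖∫ t, e t * (φ (x - t) - φ x) ∂μ‖ ≤ ∫ t, ‖e t‖ * δ ∂μ := by
          refine norm_integral_le_of_norm_le (hei.norm.mul_const _) (Eventually.of_forall fun t => ?_)
          rw [norm_mul]
          by_cases ht : t ∈ V
          · have := (hVh t ht).2 x
            rw [ccTranslate_zero, ccTranslate_apply] at this
            gcongr
          · rw [heV t ht]
            simp
      _ = δ := by rw [integral_mul_const, hnorm, one_mul]
  · rw [CompactlySupportedContinuousMap.sub_apply, hφK x hx, sub_zero, ccConv_apply]
    refine integral_eq_zero_of_ae (Eventually.of_forall fun t => ?_)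
    by_cases ht : t ∈ V
    · have := (hVh t ht).1 x hx
      rw [ccTranslate_apply] at this
      simp [this]
    · simp [heV t ht]

/-- The convolutions `e * φ` lie in the closed kernel of `Λ` and come arbitrarily close to `φ`. -/
theorem eq_zero_of_forall_ccConv {Λ : weightedOrliczS Y ω →L[ℂ] ℂ} {φ : C_c(G, ℂ)}
    (h : ∀ e, Λ (ccEmbed Y ω (ccConv μ e φ)) = 0) : Λ (ccEmbed Y ω φ) = 0 := by
  have hcl : ccEmbed Y ω φ ∈ closure (LinearMap.ker (Λ : weightedOrliczS Y ω →ₗ[ℂ] ℂ) :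
      Set (weightedOrliczS Y ω)) := by
    rw [Metric.mem_closure_iff]
    intro ε hε
    obtain ⟨e, he⟩ := exists_ccEmbed_conv_sub_le Y ω φ (half_pos hε)
    refine ⟨_, LinearMap.mem_ker.2 (h e), ?_⟩
    rw [dist_comm, dist_eq_norm]
    linarith
  have hc : IsClosed (LinearMap.ker (Λ : weightedOrliczS Y ω →ₗ[ℂ] ℂ) :
      Set (weightedOrliczS Y ω)) := Λ.isClosed_ker
  rw [hc.closure_eq] at hcl
  exact hcl

/-! ### Convolution as an integral of translates -/

/-- The bounded continuous functions on `G` that vanish off `K`. -/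
def boundedSupportedIn (K : Set G) : Submodule ℂ (G →ᵇ ℂ) where
  carrier := {f | ∀ x ∉ K, f x = 0}
  zero_mem' _ _ := rfl
  add_mem' hf hg x hx := by simp [hf x hx, hg x hx]
  smul_mem' c f hf x hx := by simp [hf x hx]

theorem isClosed_boundedSupportedIn (K : Set G) :
    IsClosed (boundedSupportedIn K : Set (G →ᵇ ℂ)) := by
  have : (boundedSupportedIn K : Set (G →ᵇ ℂ)) = ⋂ x ∈ Kᶜ, {f : G →ᵇ ℂ | f x = 0} := by
    ext f
    simp only [Set.mem_iInter, Set.mem_ofPred_eq, Set.mem_compl_iff]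
    rfl
  rw [this]
  exact isClosed_biInter fun x _ =>
    isClosed_eq (BoundedContinuousFunction.evalCLM ℂ x).continuous continuous_const

/-- A compactly supported continuous function, as a bounded continuous function. -/
noncomputable def ccBounded (φ : C_c(G, ℂ)) : G →ᵇ ℂ :=
  BoundedContinuousFunction.ofNormedAddCommGroup φ φ.continuous _
    (φ.hasCompactSupport.exists_bound_of_continuous φ.continuous).choose_spec

@[simp]
theorem ccBounded_apply (φ : C_c(G, ℂ)) (x : G) : ccBounded φ x = φ x := rfl

theorem continuous_ccBounded_translate (φ : C_c(G, ℂ)) :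
    Continuous fun t => ccBounded (ccTranslate t φ) := by
  rw [continuous_iff_continuousAt]
  intro t₀
  obtain ⟨K, -, h⟩ := exists_isCompact_eventually_translate φ t₀
  rw [ContinuousAt, Metric.tendsto_nhds]
  intro ε hε
  filter_upwards [h (ε / 2) (half_pos hε)] with t ht
  refine lt_of_le_of_lt ((BoundedContinuousFunction.dist_le (half_pos hε).le).2 fun x => ?_)
    (half_lt_self hε)
  rw [dist_eq_norm]
  exact (ht.2 x).le

/-- The element of `C_c(G)` given by a bounded continuous function with compact support. -/
noncomputable def ofBoundedSupportedIn {K : Set G} (hK : IsCompact K) :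
    boundedSupportedIn K →ₗ[ℂ] C_c(G, ℂ) where
  toFun f := ⟨⟨(f : G →ᵇ ℂ), (f : G →ᵇ ℂ).continuous⟩, HasCompactSupport.intro hK f.2⟩
  map_add' _ _ := rfl
  map_smul' _ _ := rfl

/-- A bounded functional on `S^Φ_ω(G)` can be taken under the integral sign in a convolution. -/
theorem apply_ccEmbed_ccConv (Λ : weightedOrliczS Y ω →L[ℂ] ℂ) (h φ : C_c(G, ℂ)) :
    Λ (ccEmbed Y ω (ccConv μ h φ)) = ∫ t, h t * Λ (ccEmbed Y ω (ccTranslate t φ)) ∂μ := by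
  have hK : IsCompact (tsupport h + tsupport φ) :=
    h.hasCompactSupport.isCompact.add φ.hasCompactSupport.isCompact
  set K := tsupport h + tsupport φ with hKdef
  obtain ⟨M, hM⟩ := exists_norm_ccEmbed_le Y ω hK
  -- The vector-valued integral is taken in this Banach space with the sup norm, from which the map
  -- to `S^Φ_ω(G)` is bounded; completeness of `S^Φ_ω(G)` is not needed.
  have : CompleteSpace (boundedSupportedIn K) :=
    (isClosed_boundedSupportedIn K).completeSpace_coe
  have hbound : ∀ f : boundedSupportedIn K,
      ‖(ccEmbed Y ω ∘ₗ ofBoundedSupportedIn hK) f‖ ≤ M * ‖f‖ := fun f =>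
    hM _ ‖f‖₊ (fun x => (f : G →ᵇ ℂ).norm_coe_le_norm x) f.2
  let T : boundedSupportedIn K →L[ℂ] ℂ :=
    Λ.comp ((ccEmbed Y ω ∘ₗ ofBoundedSupportedIn hK).mkContinuous M hbound)
  have hT : ∀ f, T f = Λ (ccEmbed Y ω (ofBoundedSupportedIn hK f)) := fun f => rfl
  have hmem : ∀ t, h t • ccBounded (ccTranslate t φ) ∈ boundedSupportedIn K := fun t x hx => by
    by_cases ht : t ∈ tsupport h
    · have : φ (x - t) = 0 := image_eq_zero_of_notMem_tsupport fun hφ =>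
        hx ⟨t, ht, x - t, hφ, by simp⟩
      simp [this]
    · simp [image_eq_zero_of_notMem_tsupport ht]
  let F : G → boundedSupportedIn K := fun t => ⟨h t • ccBounded (ccTranslate t φ), hmem t⟩
  have hFc : Continuous F :=
    (h.continuous.smul (continuous_ccBounded_translate φ)).subtype_mk _
  have hFs : HasCompactSupport F := HasCompactSupport.intro h.hasCompactSupport.isCompact
    fun t ht => Subtype.ext (by simp [F, image_eq_zero_of_notMem_tsupport ht])
  have hFi : Integrable F μ := hFc.integrable_of_hasCompactSupport hFs
  -- Point evaluations are bounded functionals, so the vector integral is computed pointwise.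
  have heval : ofBoundedSupportedIn hK (∫ t, F t ∂μ) = ccConv μ h φ := by
    ext x
    let E : boundedSupportedIn K →L[ℂ] ℂ :=
      (BoundedContinuousFunction.evalCLM ℂ x).comp (boundedSupportedIn K).subtypeL
    exact (E.integral_comp_comm hFi).symm
  rw [← heval, ← hT, ← T.integral_comp_comm hFi]
  refine integral_congr_ae (Eventually.of_forall fun t => ?_)
  have : ofBoundedSupportedIn hK (F t) = h t • ccTranslate t φ := rfl
  simp only [hT, this, map_smul, smul_eq_mul]

end Convolution

/-! ### Derivations -/

section Derivation

open scoped CompactlySupported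

variable {G : Type*} [AddCommGroup G] [TopologicalSpace G] [IsTopologicalAddGroup G]
  [LocallyCompactSpace G] [T2Space G] [MeasurableSpace G] [BorelSpace G]
  {μ : Measure G} [μ.IsAddHaarMeasure] [μ.Regular] {Y : YoungPair} {ω : Weight μ}

/-- The defect `D(τ_t φ)(τ_{-t} ψ) - D(φ)(ψ)` of `D` from commuting with translations. -/
noncomputable def translationDefect
    (D : weightedOrliczS Y ω →L[ℂ] (weightedOrliczS Y ω →L[ℂ] ℂ)) (t : G) (φ ψ : C_c(G, ℂ)) : ℂ :=
  D (ccEmbed Y ω (ccTranslate t φ)) (ccEmbed Y ω (ccTranslate (-t) ψ)) -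
    D (ccEmbed Y ω φ) (ccEmbed Y ω ψ)

variable {m : BoundedMul (weightedOrliczS Y ω)}
  {D : weightedOrliczS Y ω →L[ℂ] (weightedOrliczS Y ω →L[ℂ] ℂ)}

theorem derivation_ccConv
    (hm : ∀ φ ψ : C_c(G, ℂ),
      m.mul (ccEmbed Y ω φ) (ccEmbed Y ω ψ) = ccEmbed Y ω (ccConv μ φ ψ))
    (hD : m.IsDerivation D) (a b c : C_c(G, ℂ)) :
    D (ccEmbed Y ω (ccConv μ a b)) (ccEmbed Y ω c) =
      D (ccEmbed Y ω b) (ccEmbed Y ω (ccConv μ c a)) +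
        D (ccEmbed Y ω a) (ccEmbed Y ω (ccConv μ b c)) := by
  have h := congrArg (fun Λ : weightedOrliczS Y ω →L[ℂ] ℂ => Λ (ccEmbed Y ω c))
    (hD (ccEmbed Y ω a) (ccEmbed Y ω b))
  simpa [BoundedMul.dualLeft, BoundedMul.dualRight, hm] using h

/-- Both `(τ_t f) * g` and `f * (τ_t g)` equal `τ_t (f * g)`. Expanding `D` of each by the
derivation identity and testing on `τ_{-t} c` gives two expressions for one number, in which
opposite translations cancel inside convolutions. -/
theorem translationDefect_rotate
    (hm : ∀ φ ψ : C_c(G, ℂ),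
      m.mul (ccEmbed Y ω φ) (ccEmbed Y ω ψ) = ccEmbed Y ω (ccConv μ φ ψ))
    (hD : m.IsDerivation D) (t : G) (f g c : C_c(G, ℂ)) :
    translationDefect D t f (ccConv μ g c) = translationDefect D t g (ccConv μ c f) := by
  have h1 := derivation_ccConv hm hD (ccTranslate t f) g (ccTranslate (-t) c)
  have h2 := derivation_ccConv hm hD f (ccTranslate t g) (ccTranslate (-t) c)
  rw [ccConv_translate_left, ccConv_translate_right, ccConv_translate_left, ← ccTranslate_add,
    add_neg_cancel, ccTranslate_zero, ccConv_translate_right] at h1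
  rw [ccConv_translate_right, ccConv_translate_left, ccConv_translate_left, ccConv_translate_right,
    ← ccTranslate_add, add_neg_cancel, ccTranslate_zero] at h2
  unfold translationDefect
  linear_combination h2 - h1

theorem translationDefect_add
    (hm : ∀ φ ψ : C_c(G, ℂ),
      m.mul (ccEmbed Y ω φ) (ccEmbed Y ω ψ) = ccEmbed Y ω (ccConv μ φ ψ))
    (hD : m.IsDerivation D) (s t : G) (f g c : C_c(G, ℂ)) :
    translationDefect D (s + t) f (ccConv μ g c) =
      translationDefect D s f (ccConv μ g c) + translationDefect D t f (ccConv μ g c) := by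
  have h1 : translationDefect D (s + t) f (ccConv μ g c) =
      translationDefect D s (ccTranslate t f) (ccTranslate (-t) (ccConv μ g c)) +
        translationDefect D t f (ccConv μ g c) := by
    unfold translationDefect
    rw [ccTranslate_add s t, neg_add, ccTranslate_add (-s) (-t)]
    ring
  -- One rotation brings `τ_{-t} c` and `τ_t f` into the same convolution, where the shifts cancel;
  -- two further rotations complete the cycle of order three.
  have h2 : translationDefect D s (ccTranslate t f) (ccTranslate (-t) (ccConv μ g c)) =
      translationDefect D s f (ccConv μ g c) := by
    rw [← ccConv_translate_right, translationDefect_rotate hm hD, ccConv_translate_left,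
      ccConv_translate_right, ← ccTranslate_add, neg_add_cancel, ccTranslate_zero,
      translationDefect_rotate hm hD, translationDefect_rotate hm hD]
  rw [h1, h2]

theorem continuous_translationDefect
    (D : weightedOrliczS Y ω →L[ℂ] (weightedOrliczS Y ω →L[ℂ] ℂ)) (φ ψ : C_c(G, ℂ)) :
    Continuous fun t => translationDefect D t φ ψ :=
  ((D.continuous.comp (continuous_ccEmbed_translate Y ω φ)).clm_apply
    ((continuous_ccEmbed_translate Y ω ψ).comp continuous_neg)).sub continuous_const

theorem exists_norm_apply_apply_le {A : Type*} [NormedAddCommGroup A] [NormedSpace ℂ A]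
    (D : A →L[ℂ] (A →L[ℂ] ℂ)) : ∃ N : ℝ, 0 ≤ N ∧ ∀ a b, ‖D a b‖ ≤ N * ‖a‖ * ‖b‖ :=
  ⟨‖D‖, D.opNorm_nonneg, D.le_opNorm₂⟩

theorem exists_norm_translationDefect_le
    (D : weightedOrliczS Y ω →L[ℂ] (weightedOrliczS Y ω →L[ℂ] ℂ)) (φ ψ : C_c(G, ℂ)) :
    ∃ B : ℝ, ∀ t, ‖translationDefect D t φ ψ‖ ≤ B * (ω t * ω (-t)) := by
  obtain ⟨C, hC, hsub⟩ := ω.weakly_submultiplicative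
  obtain ⟨N₀, hN₀, hD⟩ := exists_norm_apply_apply_le D
  set N : ℝ := N₀ * ‖ccEmbed Y ω φ‖ * ‖ccEmbed Y ω ψ‖ with hN
  have hN0 : 0 ≤ N := by positivity
  -- The first summand bounds the translated term. The second absorbs the constant term, since `1 =
  -- ω(0) ≤ C ω(t) ω(-t)`.
  refine ⟨N * (C * C) + N * C, fun t => ?_⟩
  have h1 := norm_ccEmbed_translate_le Y ω hC hsub t φ
  have h2 := norm_ccEmbed_translate_le Y ω hC hsub (-t) ψ
  have h3 := hsub t (-t)
  rw [add_neg_cancel, ω.map_zero] at h3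
  have hp := (ω.pos t).le
  have hp' := (ω.pos (-t)).le
  calc ‖translationDefect D t φ ψ‖
      ≤ N₀ * ‖ccEmbed Y ω (ccTranslate t φ)‖ * ‖ccEmbed Y ω (ccTranslate (-t) ψ)‖ + N :=
        (norm_sub_le _ _).trans (add_le_add (hD _ _) (hD _ _))
    _ ≤ N₀ * (C * ω t * ‖ccEmbed Y ω φ‖) * (C * ω (-t) * ‖ccEmbed Y ω ψ‖) +
          N * (C * (ω t * ω (-t))) := by
        refine add_le_add (by gcongr) (le_mul_of_one_le_right hN0 h3)
    _ = _ := by rw [hN]; ring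

/-- In the absence of additive characters dominated by `ω(t) ω(-t)`, derivations commute with
translations. -/
theorem translationDefect_eq_zero
    (hm : ∀ φ ψ : C_c(G, ℂ),
      m.mul (ccEmbed Y ω φ) (ccEmbed Y ω ψ) = ccEmbed Y ω (ccConv μ φ ψ))
    (hD : m.IsDerivation D)
    (hξ : ¬ ∃ ξ : G →ₜ+ ℂ, ξ ≠ 0 ∧ MemLp (fun s => ξ s / ((ω s * ω (-s) : ℝ) : ℂ)) ∞ μ)
    (t : G) (f g c : C_c(G, ℂ)) : translationDefect D t f (ccConv μ g c) = 0 := by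
  let ξ : G →ₜ+ ℂ :=
    { toFun := fun t => translationDefect D t f (ccConv μ g c)
      map_zero' := by simp [translationDefect]
      map_add' := fun s t => translationDefect_add hm hD s t f g c
      continuous_toFun := continuous_translationDefect D f (ccConv μ g c) }
  have hξ' : ∀ t, ξ t = translationDefect D t f (ccConv μ g c) := fun t => rfl
  by_contra hne
  refine hξ ⟨ξ, fun h => hne ?_, ?_⟩
  · rw [← hξ', h]
    rfl
  obtain ⟨B, hB⟩ := exists_norm_translationDefect_le D f (ccConv μ g c)
  have hneg : AEMeasurable (fun s => ω (-s)) μ :=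
    ω.aemeasurable.comp_quasiMeasurePreserving
      (Measure.measurePreserving_neg μ).quasiMeasurePreserving
  have hmeas : AEMeasurable (fun s => ((ω s * ω (-s) : ℝ) : ℂ)) μ :=
    Complex.measurable_ofReal.comp_aemeasurable (ω.aemeasurable.mul hneg)
  refine memLp_top_of_bound
    (ξ.continuous_toFun.measurable.aemeasurable.div hmeas).aestronglyMeasurable B
    (Eventually.of_forall fun s => ?_)
  have hpos := mul_pos (ω.pos s) (ω.pos (-s))
  rw [norm_div, Complex.norm_real, Real.norm_of_nonneg hpos.le, div_le_iff₀ hpos]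
  exact hB s

theorem derivation_eq_zero
    (hm : ∀ φ ψ : C_c(G, ℂ),
      m.mul (ccEmbed Y ω φ) (ccEmbed Y ω ψ) = ccEmbed Y ω (ccConv μ φ ψ))
    (hD : m.IsDerivation D)
    (hξ : ¬ ∃ ξ : G →ₜ+ ℂ, ξ ≠ 0 ∧ MemLp (fun s => ξ s / ((ω s * ω (-s) : ℝ) : ℂ)) ∞ μ) :
    D = 0 := by
  have htrans : ∀ (t : G) (f g c : C_c(G, ℂ)),
      D (ccEmbed Y ω (ccTranslate t f)) (ccEmbed Y ω (ccConv μ g c)) =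
        D (ccEmbed Y ω f) (ccEmbed Y ω (ccTranslate t (ccConv μ g c))) := fun t f g c => by
    -- Inserting `τ_t g` for `g` cancels the shift by `-t` in the second argument.
    have h := translationDefect_eq_zero hm hD hξ t f (ccTranslate t g) c
    rw [translationDefect, sub_eq_zero, ccConv_translate_left, ← ccTranslate_add, neg_add_cancel,
      ccTranslate_zero] at h
    exact h
  have hinv : ∀ h f g c : C_c(G, ℂ),
      D (ccEmbed Y ω (ccConv μ h f)) (ccEmbed Y ω (ccConv μ g c)) =
        D (ccEmbed Y ω f) (ccEmbed Y ω (ccConv μ h (ccConv μ g c))) := fun h f g c => by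
    have h1 := apply_ccEmbed_ccConv (D.flip (ccEmbed Y ω (ccConv μ g c))) h f
    simp only [ContinuousLinearMap.flip_apply, htrans] at h1
    rw [h1, apply_ccEmbed_ccConv]
  -- With `k = g * c`, the left side `D(h * f)(k) = D(f)(h * k)` equals the first term `D(f)(k * h)`
  -- of the derivation identity by commutativity, so the other term vanishes.
  have hvan : ∀ h f g c : C_c(G, ℂ),
      D (ccEmbed Y ω h) (ccEmbed Y ω (ccConv μ f (ccConv μ g c))) = 0 := fun h f g c => by
    have h1 := derivation_ccConv hm hD h f (ccConv μ g c)
    rw [hinv, ccConv_comm (ccConv μ g c) h] at h1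
    exact left_eq_add.1 h1
  have hzero : ∀ h c : C_c(G, ℂ), D (ccEmbed Y ω h) (ccEmbed Y ω c) = 0 := fun h c =>
    -- The approximate identity is used twice, for `c` and then for `g * c`.
    eq_zero_of_forall_ccConv fun g => eq_zero_of_forall_ccConv fun f => hvan h f g c
  refine ContinuousLinearMap.coeFn_injective
    ((denseRange_ccEmbed Y ω).equalizer D.continuous continuous_const (funext fun h => ?_))
  refine ContinuousLinearMap.coeFn_injective ((denseRange_ccEmbed Y ω).equalizer
    (D (ccEmbed Y ω h)).continuous continuous_const (funext fun c => hzero h c))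

end Derivation

end WeightedOrlicz

theorem mainTheorem1 {G : Type*} [AddCommGroup G] [TopologicalSpace G] [IsTopologicalAddGroup G]
    [LocallyCompactSpace G] [T2Space G] [MeasurableSpace G] [BorelSpace G]
    (μ : Measure G) [μ.IsAddHaarMeasure] [μ.Regular]
    (Y : WeightedOrlicz.YoungPair) (ω : WeightedOrlicz.Weight μ)
    (hL : WeightedOrlicz.IsWeightedOrliczAlgebra Y ω)
    (hξ : ¬ ∃ ξ : G →ₜ+ ℂ, ξ ≠ 0 ∧ MemLp (fun s => ξ s / ((ω s * ω (-s) : ℝ) : ℂ)) ∞ μ) :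
    WeightedOrlicz.IsWeaklyAmenableS Y ω := by
  obtain ⟨m, hm⟩ := hL
  refine ⟨WeightedOrlicz.restrictMul hm, WeightedOrlicz.isConvolution_restrictMul hm,
    fun D hD => ⟨0, fun a => ?_⟩⟩
  rw [WeightedOrlicz.derivation_eq_zero (WeightedOrlicz.restrictMul_ccEmbed hm) hD hξ]
  simp [WeightedOrlicz.BoundedMul.dualLeft, WeightedOrlicz.BoundedMul.dualRight]
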